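/- Let $n\ge 1$ and let $\Sigma$ be a fan in $\mathbb R^m$ (a finite collection of strongly convex rational polyhedral cones, closed under faces, any two meeting in a common face) with $\{\{\mathbf 0\}\}\subsetneq\Sigma$. Let $\rho_1,\dots,\rho_r$ be its one-dimensional cones and $\mathbf n_k\in\mathbb Z^m$ the primitive generator of $\rho_k$. Put $$\mathcal K_\Sigma=\{\{i_1,\dots,i_s\}\subset[r]:\mathbf n_{i_1},\dots,\mathbf n_{i_s}\text{ span a cone in }\Sigma\},$$ $$\mathcal K_\Sigma(n)=\{\tau\subset[r]\times[n]:\sigma\times[n]\not\subset\tau\text{ for every }\sigma\subset[r]\text{ with }\sigma\notin\mathcal K_\Sigma\};$$ the latter is a simplicial complex on $[r]\times[n]$. For a simplicial complex $K$ on a finite set $V$ and a pair $(X,A)$ let $\mathcal Z_K(X,A)=\bigcup_{\sigma\in K}\{x\in X^V: x_k\in A\text{ for }k\notin\sigma\}$ be the polyhedral product, and let $DJ(K)=\mathcal Z_K(\mathbb{CP}^\infty,*)$ be the Davis--Januszkiewicz space. Let $\mathrm{SP}^d(X)=X^d/S_d$, whose elements are regarded as configurations of $d$ points with multiplicities. For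 $D=(d_1,\dots,d_r)$ with all $d_i\ge 1$ let $E_n^{D,\Sigma}(X)\subset\prod_{i=1}^r\mathrm{SP}^{d_i}(X)^n$ be the space of all $(\xi_{i,j})$ such that $\bigcap_{(i,j)\in\sigma\times[n]}\xi_{i,j}=\emptyset$ for every $\sigma\subset[r]$ with $\sigma\notin\mathcal K_\Sigma$. Let $\overline U\subset\mathbb C$ be the closed unit disc, and let $E^\Sigma_n(\overline U,\partial\overline U)=\bigcup_D E_n^{D,\Sigma}(\overline U)/{\sim}$, where tuples are identified if they agree outside $\partial\overline U$, where $D$ is increased by adding points of $\partial\overline U$, and where the union has the colimit topology. Similarly let $\mathrm{SP}^\infty(S^2,\infty)=\bigcup_{d\ge1}\mathrm{SP}^d(S^2)/{\sim}$, where $S^2=\mathbb C\cup\infty$, configurations are identified if they agree outside $\infty$, and the union has the colimit topology; its base point is the empty configuration. Then there is a homotopy equivalence $$r_\Sigma: E^\Sigma_n(\overline U,\partial\overline U)\xrightarrow{\ \simeq\ }DJ(\mathcal K_\Sigma(n)).$$ More precisely, there is a based homeomorphism $h:\mathrm{SP}^\infty(S^2,\infty)\cong\mathbb{CP}^\infty$,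 and the identification $\overline U/\partial\overline U\cong S^2$, $z\mapsto z/(1-|z|)$ for $|z|<1$, $\partial\overline U\mapsto\infty$, induces a continuous inclusion $$\iota:\mathcal Z_{\mathcal K_\Sigma(n)}(\mathrm{SP}^\infty(S^2,\infty),\emptyset)\to E^\Sigma_n(\overline U,\partial\overline U).$$ There are a continuous map $\mathrm{ret}$ in the opposite direction with $\mathrm{ret}\circ\iota=\mathrm{id}$ and a homotopy $H_t$ from the identity to $\iota\circ\mathrm{ret}$ that fixes the image of $\iota$ pointwise. This $H$ is a radial expansion: for a continuous function $\lambda\ge1$ of $(t,\eta)$, the configurations $H_t(\eta)_{i,j}$ are obtained from $\eta_{i,j}$ by multiplying every point by $\lambda(t,\eta)$ and dropping the points that leave the open unit disc. The map $r_\Sigma$ is $\mathrm{ret}$ followed by $h$ in every coordinate. -/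

import Mathlib

open Set Topology

noncomputable section

/-! ### Fans in `ℝ^m` -/

/-- The inclusion `ℤ^m ⊂ ℝ^m`. -/
def latticeVec {m : ℕ} (v : Fin m → ℤ) : Fin m → ℝ := fun k => (v k : ℝ)

/-- `Cone(S) = {∑ λ_v v : λ_v ≥ 0}` for a set `S` of lattice vectors; `Cone(∅) = {0}`. -/
def latticeCone {m : ℕ} (S : Set (Fin m → ℤ)) : PointedCone ℝ (Fin m → ℝ) :=
  PointedCone.hull ℝ (latticeVec '' S)

/-- `τ = σ ∩ {L = 0}` for some linear form `L` that is nonnegative on `σ`. -/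
def IsConeFace {m : ℕ} (τ σ : PointedCone ℝ (Fin m → ℝ)) : Prop :=
  ∃ L : (Fin m → ℝ) →ₗ[ℝ] ℝ, (∀ x ∈ σ, 0 ≤ L x) ∧ ∀ x, x ∈ τ ↔ x ∈ σ ∧ L x = 0

/-- A fan in `ℝ^m`: a finite collection of strongly convex rational polyhedral cones which is closed
under passing to faces, and in which any two cones meet in a common face. -/
structure Fan (m : ℕ) where
  cones : Set (PointedCone ℝ (Fin m → ℝ))
  finite : cones.Finite
  rational : ∀ σ ∈ cones, ∃ S : Finset (Fin m → ℤ), σ = latticeCone (S : Set (Fin m → ℤ))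
  stronglyConvex : ∀ σ ∈ cones, ∀ x ∈ σ, -x ∈ σ → x = 0
  face_mem : ∀ σ ∈ cones, ∀ τ, IsConeFace τ σ → τ ∈ cones
  inter_mem : ∀ σ₁ ∈ cones, ∀ σ₂ ∈ cones, σ₁ ⊓ σ₂ ∈ cones
  inter_face : ∀ σ₁ ∈ cones, ∀ σ₂ ∈ cones,
    IsConeFace (σ₁ ⊓ σ₂) σ₁ ∧ IsConeFace (σ₁ ⊓ σ₂) σ₂

/-- The dimension of a cone: the dimension of its linear span. -/
def coneDim {m : ℕ} (σ : PointedCone ℝ (Fin m → ℝ)) : ℕ :=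
  Module.finrank ℝ (Submodule.span ℝ (σ : Set (Fin m → ℝ)))

/-- `Σ(1)`, the set of all one-dimensional cones of a fan. -/
def Fan.rays {m : ℕ} (F : Fan m) : Set (PointedCone ℝ (Fin m → ℝ)) :=
  {ρ | ρ ∈ F.cones ∧ coneDim ρ = 1}

/-- `v` is the primitive generator of `ρ`: `ρ ∩ ℤ^m = ℤ_{≥ 0} · v`. -/
def IsPrimitiveGenerator {m : ℕ} (ρ : PointedCone ℝ (Fin m → ℝ)) (v : Fin m → ℤ) : Prop :=
  {w : Fin m → ℤ | latticeVec w ∈ ρ} = {w | ∃ a : ℕ, w = a • v}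

/-! ### Families of faces and polyhedral products -/

/-- `K_Σ`: the subsets `{i_1, …, i_s}` of `[r]` for which `n_{i_1}, …, n_{i_s}` span a cone of the
fan, where `v k = n_k` are the primitive generators of the rays. -/
def fanComplex {m r : ℕ} (F : Fan m) (v : Fin r → Fin m → ℤ) : Set (Finset (Fin r)) :=
  {s | latticeCone (v '' (s : Set (Fin r))) ∈ F.cones}

/-- `K(n)`: the subsets `τ` of `[r] × [n]` that contain `σ × [n]` for no non-face `σ` of `K`. -/
def thickComplex {r : ℕ} (K : Set (Finset (Fin r))) (n : ℕ) : Set (Finset (Fin r × Fin n)) :=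
  {τ | ∀ σ : Finset (Fin r), σ ∉ K → ¬ (σ ×ˢ (Finset.univ : Finset (Fin n)) ⊆ τ)}

/-- `K(n)` is closed under passing to subsets. -/
theorem thickComplex_down_closed {r n : ℕ} {K : Set (Finset (Fin r))}
    {τ τ' : Finset (Fin r × Fin n)} (h : τ ∈ thickComplex K n) (h' : τ' ⊆ τ) :
    τ' ∈ thickComplex K n :=
  fun σ hσ hs => h σ hσ (hs.trans h')

/-- `K(n)` contains the empty set, provided that `K` does and `n ≥ 1`. -/
theorem empty_mem_thickComplex {r n : ℕ} {K : Set (Finset (Fin r))} (h : ∅ ∈ K) (hn : 1 ≤ n) :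
    ∅ ∈ thickComplex K n := by
  intro σ hσ hs
  rw [Finset.subset_empty, Finset.product_eq_empty] at hs
  rcases hs with rfl | hs
  · exact hσ h
  · have : (⟨0, hn⟩ : Fin n) ∈ (Finset.univ : Finset (Fin n)) := Finset.mem_univ _
    simp [hs] at this

/-- The polyhedral product `Z_K(X, A) = ⋃_{σ ∈ K} {x ∈ X^V : x_v ∈ A for v ∉ σ}`, with the subspace
topology of the product. -/
def polyProd {V : Type} (K : Set (Finset V)) (X : Type) (A : Set X) : Set (V → X) :=
  {x | ∃ σ ∈ K, ∀ v, v ∉ σ → x v ∈ A}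

/-! ### Infinite complex projective space -/

/-- A vector of `ℂ^{N+1}`, extended by zero to a sequence of complex numbers. -/
def extendZero {N : ℕ} (v : Fin (N + 1) → ℂ) (k : ℕ) : ℂ :=
  if h : k < N + 1 then v ⟨k, h⟩ else 0

/-- Nonzero vectors of `⋃_N ℂ^{N+1}`, up to multiplication by nonzero scalars. -/
def cpSetoid : Setoid ((N : ℕ) × {v : Fin (N + 1) → ℂ // v ≠ 0}) where
  r p q := ∃ c : ℂ, c ≠ 0 ∧ ∀ k, extendZero q.2.1 k = c * extendZero p.2.1 k
  iseqv :=
    { refl := fun _ => ⟨1, one_ne_zero, fun _ => (one_mul _).symm⟩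
      symm := by
        rintro p q ⟨c, hc, h⟩
        exact ⟨c⁻¹, inv_ne_zero hc, fun k => by rw [h k, inv_mul_cancel_left₀ hc]⟩
      trans := by
        rintro p q s ⟨c, hc, h⟩ ⟨d, hd, h'⟩
        exact ⟨d * c, mul_ne_zero hd hc, fun k => by rw [h' k, h k, mul_assoc]⟩ }

/-- `ℂP^∞ = ⋃_N ℂP^N`. The quotient topology, from the disjoint union of the spaces
`ℂ^{N+1} ∖ {0}`, is the colimit topology of the spaces `ℂP^N`. -/
def CPInf : Type := Quotient cpSetoid

instance : TopologicalSpace CPInf := inferInstanceAs (TopologicalSpace (Quotient cpSetoid))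

/-- The base point `[1 : 0 : 0 : ⋯]` of `ℂP^∞`. -/
def CPInf.base : CPInf := Quotient.mk cpSetoid ⟨0, ⟨fun _ => 1, fun h => one_ne_zero (congrFun h 0)⟩⟩

/-- The Davis–Januszkiewicz space `DJ(K) = Z_K(ℂP^∞, *)`. -/
abbrev DJ {V : Type} (K : Set (Finset V)) : Type := ↥(polyProd K CPInf {CPInf.base})

/-! ### Symmetric products -/

/-- Two `d`-tuples in the same orbit of the symmetric group. -/
def permSetoid (d : ℕ) (X : Type) : Setoid (Fin d → X) where
  r x y := ∃ g : Equiv.Perm (Fin d), y = x ∘ g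
  iseqv :=
    { refl := fun _ => ⟨1, rfl⟩
      symm := by
        rintro x y ⟨g, rfl⟩
        exact ⟨g⁻¹, by ext; simp⟩
      trans := by
        rintro x y z ⟨g, rfl⟩ ⟨g', rfl⟩
        exact ⟨g * g', rfl⟩ }

/-- The symmetric product `SP^d(X) = X^d / S_d`, with the quotient topology. -/
def SP (d : ℕ) (X : Type) : Type := Quotient (permSetoid d X)

instance (d : ℕ) (X : Type) [TopologicalSpace X] : TopologicalSpace (SP d X) :=
  inferInstanceAs (TopologicalSpace (Quotient (permSetoid d X)))

/-- The points of a configuration, with their multiplicities. -/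
def SP.toMultiset {d : ℕ} {X : Type} : SP d X → Multiset X :=
  Quotient.lift (s := permSetoid d X) (fun x => (Finset.univ : Finset (Fin d)).val.map x) (by
    rintro x y ⟨g, rfl⟩
    rw [← Multiset.map_map]
    congr 1
    exact (congrArg Finset.val (Finset.map_univ_equiv g)).symm)

open Classical in
/-- `η ∩ (X ∖ A)`: the points of a configuration outside `A`, with their multiplicities. -/
def awayFrom {X : Type} (A : Set X) (η : Multiset X) : Multiset X := η.filter (fun x => x ∉ A)

/-- Configurations of arbitrary degree `d ≥ 1` which agree outside `A`. -/
def spSetoid (X : Type) (A : Set X) : Setoid ((d : ℕ+) × SP d X) :=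
  Setoid.ker fun p => awayFrom A p.2.toMultiset

/-- `SP^∞(X, A) = ⋃_d SP^d(X, A)`, where `SP^d(X, A)` is the quotient of `SP^d(X)` in which
configurations that agree outside `A` are identified, and `SP^d(X, A) ⊂ SP^{d+1}(X, A)` by adding a
point of `A`. The quotient topology, from the disjoint union of the `SP^d(X)`, is the colimit
topology of this union. -/
def SPInf (X : Type) (A : Set X) : Type := Quotient (spSetoid X A)

instance (X : Type) [TopologicalSpace X] (A : Set X) : TopologicalSpace (SPInf X A) :=
  inferInstanceAs (TopologicalSpace (Quotient (spSetoid X A)))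

/-- The points outside `A` of an element of `SP^∞(X, A)`. -/
def SPInf.points {X : Type} {A : Set X} : SPInf X A → Multiset X :=
  Quotient.lift (s := spSetoid X A) (fun p => awayFrom A p.2.toMultiset) (fun _ _ h => h)

/-! ### The configuration spaces `E_n` -/

/-- `E_n^D(X) ⊂ ∏_i SP^{d_i}(X)^n`: the tuples `(ξ_{i,j})` such that
`⋂_{(i,j) ∈ σ × [n]} ξ_{i,j} = ∅` for every non-face `σ` of `K`. -/
def ConfD {r : ℕ} (K : Set (Finset (Fin r))) (n : ℕ) (X : Type) (D : Fin r → ℕ+) : Type :=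
  {ξ : (i : Fin r) → Fin n → SP (D i) X //
    ∀ σ : Finset (Fin r), σ ∉ K → ¬ ∃ x : X, ∀ i ∈ σ, ∀ j : Fin n, x ∈ (ξ i j).toMultiset}

instance {r : ℕ} (K : Set (Finset (Fin r))) (n : ℕ) (X : Type) [TopologicalSpace X]
    (D : Fin r → ℕ+) : TopologicalSpace (ConfD K n X D) :=
  inferInstanceAs (TopologicalSpace {ξ : (i : Fin r) → Fin n → SP (D i) X //
    ∀ σ : Finset (Fin r), σ ∉ K → ¬ ∃ x : X, ∀ i ∈ σ, ∀ j : Fin n, x ∈ (ξ i j).toMultiset})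

/-- Tuples of configurations, of arbitrary degrees `D`, which agree outside `A`. -/
def confSetoid {r : ℕ} (K : Set (Finset (Fin r))) (n : ℕ) (X : Type) (A : Set X) :
    Setoid ((D : Fin r → ℕ+) × ConfD K n X D) :=
  Setoid.ker fun p => fun (i : Fin r) (j : Fin n) => awayFrom A (p.2.1 i j).toMultiset

/-- `E_n(X, A) = ⋃_D E_n^D(X, A)`, where `E_n^D(X, A)` is the quotient of `E_n^D(X)` in which tuples
that agree outside `A` are identified, and the inclusions `E_n^D(X, A) ⊂ E_n^{D+e_i}(X, A)` add
points of `A`. The quotient topology, from the disjoint union of the `E_n^D(X)`, is the colimit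
topology of this union. -/
def Conf {r : ℕ} (K : Set (Finset (Fin r))) (n : ℕ) (X : Type) (A : Set X) : Type :=
  Quotient (confSetoid K n X A)

instance {r : ℕ} (K : Set (Finset (Fin r))) (n : ℕ) (X : Type) [TopologicalSpace X] (A : Set X) :
    TopologicalSpace (Conf K n X A) :=
  inferInstanceAs (TopologicalSpace (Quotient (confSetoid K n X A)))

/-- The points outside `A` of the configuration with index `(i, j)`. -/
def Conf.points {r : ℕ} {K : Set (Finset (Fin r))} {n : ℕ} {X : Type} {A : Set X}
    (η : Conf K n X A) : Fin r → Fin n → Multiset X :=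
  Quotient.lift (s := confSetoid K n X A)
    (fun p => fun (i : Fin r) (j : Fin n) => awayFrom A (p.2.1 i j).toMultiset) (fun _ _ h => h) η

/-! ### The disc and the sphere -/

/-- The closed unit disc `Ū ⊂ ℂ`. -/
abbrev Disc : Type := ↥(Metric.closedBall (0 : ℂ) 1)

/-- The boundary circle `∂Ū`, as a subset of `Ū`. -/
def discBoundary : Set Disc := {z | (z : ℂ) ∈ Metric.sphere (0 : ℂ) 1}

/-- `E_n(Ū, ∂Ū)`. -/
abbrev DiscConf {r : ℕ} (K : Set (Finset (Fin r))) (n : ℕ) : Type := Conf K n Disc discBoundary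

/-- `SP^∞(S², ∞)`, where `S² = ℂ ∪ ∞`. -/
abbrev SPSphere : Type := SPInf (OnePoint ℂ) {OnePoint.infty}

open Classical in
/-- The standard identification of `Ū / ∂Ū` with `S² = ℂ ∪ ∞`: the point `z` with `|z| < 1` goes to
`z / (1 - |z|)`, and the boundary circle goes to `∞`. -/
def collapse (z : Disc) : OnePoint ℂ :=
  if ‖(z : ℂ)‖ < 1 then ((((1 - ‖(z : ℂ)‖)⁻¹ : ℝ) • (z : ℂ) : ℂ) : OnePoint ℂ) else OnePoint.infty

/-- Radial expansion by the factor `l` of a configuration in the disc: every point `z` moves to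
`l • z`, and the points that leave the open unit disc are dropped. -/
def radialExpand (l : ℝ) (η : Multiset Disc) : Multiset ℂ :=
  awayFrom {w : ℂ | 1 ≤ ‖w‖} (η.map (fun z : Disc => l • (z : ℂ)))

end

/-! A non-face is a subset `σ` of `[r]` outside `K_Σ`. Radial expansion pushes points of a
configuration onto the boundary circle, where they vanish. For each non-face `σ` the origin is not a
common point, so some configuration with index in `σ × [n]` misses it, and a large enough expansion
empties that configuration. The nonempty configurations are then indexed by a face of `K(n)`, which
means that the tuple lies in the polyhedral product of `SP^∞(S², ∞)`. The factor `1 / margin η`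
suffices, where `margin` is the minimum over non-faces of the maximum over `σ × [n]` of the distance
to the origin, capped at 1. It is positive (`margin_pos`), continuous (`continuous_margin`), and
equal to 1 on the polyhedral product (`margin_inclConf`), so interpolating between 1 and `1 / margin
η` gives a deformation that fixes the polyhedral product.

The space `SP^∞(S², ∞)` is `ℂP^∞` because a configuration is the root set of a polynomial up to
scalars, missing degrees being roots at infinity. Both spaces are quotients of the disjoint union of
the powers of the disc, with the same fibres (`isQuotientMap_sphereOfTuple`,
`isQuotientMap_cpOfTuple`, `cpOfTuple_eq_iff`).

The remaining work is continuity for the colimit topologies. Maps out of the configuration space are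
tested on tuples of points (`isQuotientMap_confOfTuple`); maps into it are lifted locally to tuples
(`continuousAt_of_lift`). Such a lift must have no common points even on the boundary, so vanished
points are replaced by distinct boundary points. This is harmless as long as every non-face has two
elements (`NoCommonPoint.pad`), which is all that is used about the fan
(`nontrivial_of_notMem_fanComplex`). Continuity of the inclusion also needs that finite powers of
`SP^∞(S², ∞)` carry the colimit topology (`isOpen_of_forall_box`). -/

noncomputable section

/-! ### Finite products of colimits of compact spaces -/

/-- The tube lemma for finite powers. -/
theorem exists_open_box {S : Type} [TopologicalSpace S] {V : Type} [Finite V] (A : V → Set S)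
    (hA : ∀ v, IsCompact (A v)) (O : Set (V → S)) (hO : IsOpen O) (hAO : univ.pi A ⊆ O) :
    ∃ G : V → Set S, (∀ v, IsOpen (G v)) ∧ (∀ v, A v ⊆ G v) ∧ univ.pi G ⊆ O := by
  induction V using Finite.induction_empty_option with
  | of_equiv e ih =>
    obtain ⟨G, hG, hAG, hGO⟩ := ih (A ∘ e) (fun v => hA _) ((fun f => f ∘ e.symm) ⁻¹' O)
      (hO.preimage (by fun_prop)) (by
        intro f hf
        apply hAO
        intro v _
        simpa using hf (e.symm v) (mem_univ _))
    refine ⟨G ∘ e.symm, fun v => hG _, fun v => ?_, fun f hf => ?_⟩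
    · simpa using hAG (e.symm v)
    · have := @hGO (f ∘ e) (fun v _ => by simpa using hf (e v) (mem_univ _))
      simpa [Function.comp_assoc] using this
  | h_empty =>
    exact ⟨fun _ => univ, fun _ => isOpen_univ, fun _ => subset_univ _,
      fun f _ => hAO fun v => v.elim⟩
  | h_option ih =>
    rename_i α _
    have hc : Continuous fun p : S × (α → S) => (fun o : Option α => o.elim p.1 p.2) := by
      refine continuous_pi fun o => ?_
      cases o <;> simp <;> fun_prop
    obtain ⟨U, W, hU, hW, hAU, hAW, hUW⟩ := generalized_tube_lemma (hA none)
      (isCompact_univ_pi fun v : α => hA (some v)) (hO.preimage hc) (by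
        rintro ⟨s, f⟩ ⟨hs, hf⟩
        apply hAO
        rintro (_ | v) -
        · exact hs
        · exact hf v (mem_univ _))
    obtain ⟨G, hG, hAG, hGO⟩ := ih (A ∘ some) (fun v => hA _) W hW hAW
    refine ⟨fun o => o.elim U G, ?_, ?_, fun f hf => ?_⟩
    · rintro (_ | v)
      exacts [hU, hG v]
    · rintro (_ | v)
      exacts [hAU, hAG v]
    · have := @hUW (f none, f ∘ some)
        ⟨hf none (mem_univ _), hGO fun v _ => hf (some v) (mem_univ _)⟩
      have h' : (fun o : Option α => o.elim (f none) (f ∘ some)) = f := by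
        ext o; cases o <;> rfl
      simpa [h'] using this

/-- Between a compact set `A` and an open set `G ⊇ A` there is, relative to a compact set `C`, a compact
neighbourhood of `A`. -/
theorem exists_compact_between_rel {S : Type} [TopologicalSpace S] [T2Space S] {A C G : Set S}
    (hA : IsCompact A) (hC : IsCompact C) (hG : IsOpen G) (hAG : A ⊆ G) :
    ∃ B N : Set S, IsCompact B ∧ IsOpen N ∧ A ⊆ N ∧ N ∩ C ⊆ B ∧ B ⊆ C ∧ B ⊆ G := by
  -- Separate `A` from the part of `C` outside `G`; `B` is `C` without the neighbourhood `M` of that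
  -- part.
  obtain ⟨N, M, hN, hM, hAN, hCM, hNM⟩ := SeparatedNhds.of_isCompact_isCompact hA (hC.diff hG)
    (disjoint_left.2 fun x hx hx' => hx'.2 (hAG hx))
  refine ⟨C \ M, N, hC.diff hM, hN, hAN, ?_, sdiff_subset, ?_⟩
  · exact fun x hx => ⟨hx.2, fun h => disjoint_left.1 hNM hx.1 h⟩
  · intro x hx
    by_contra h
    exact hx.2 (hCM ⟨hx.1, h⟩)

/-- The finite powers of the colimit of a sequence of compact Hausdorff spaces carry the colimit
topology. -/
theorem isOpen_of_forall_box {S : Type} [TopologicalSpace S] [T2Space S] {V : Type} [Finite V]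
    (C : ℕ → Set S) (hC : ∀ d, IsCompact (C d)) (hmono : Monotone C) (hcov : ⋃ d, C d = univ)
    (hcoh : ∀ U : Set S, (∀ d, ∃ O, IsOpen O ∧ U ∩ C d = O ∩ C d) → IsOpen U)
    (W : Set (V → S))
    (hW : ∀ d, ∃ O, IsOpen O ∧ W ∩ univ.pi (fun _ => C d) = O ∩ univ.pi (fun _ => C d)) :
    IsOpen W := by
  have := Fintype.ofFinite V
  rw [isOpen_iff_forall_mem_open]
  intro x hx
  obtain ⟨d₀, hd₀⟩ : ∃ d, ∀ v, x v ∈ C d := by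
    have h : ∀ v, ∃ d, x v ∈ C d := fun v => by simpa using hcov.symm.subset (mem_univ (x v))
    choose d hd using h
    exact ⟨Finset.univ.sup d, fun v => hmono (Finset.le_sup (Finset.mem_univ v)) (hd v)⟩
  -- Stage `k` is a box of compact subsets of `C (d₀ + k)` inside `W`. Each box is chosen to be a
  -- neighbourhood of the previous one relative to the next `C`, so that the union of all stages is
  -- an open box around `x`.
  let T : ℕ → Type := fun k =>
    {A : V → Set S // (∀ v, IsCompact (A v)) ∧ (∀ v, A v ⊆ C (d₀ + k)) ∧ univ.pi A ⊆ W}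
  have step : ∀ k (A : T k), ∃ B : T (k + 1), ∃ N : V → Set S,
      ∀ v, IsOpen (N v) ∧ A.1 v ⊆ N v ∧ N v ∩ C (d₀ + (k + 1)) ⊆ B.1 v := by
    rintro k ⟨A, hA, hAC, hAW⟩
    have hAC' : ∀ v, A v ⊆ C (d₀ + (k + 1)) := fun v => (hAC v).trans (hmono (by omega))
    obtain ⟨O, hO, hWO⟩ := hW (d₀ + (k + 1))
    obtain ⟨G, hG, hAG, hGO⟩ := exists_open_box A hA O hO fun f hf =>
      (hWO.subset ⟨hAW hf, fun v hv => hAC' v (hf v hv)⟩).1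
    choose B N hB hN hAN hNB hBC hBG using fun v =>
      exists_compact_between_rel (hA v) (hC (d₀ + (k + 1))) (hG v) (hAG v)
    refine ⟨⟨B, hB, hBC, fun f hf => ?_⟩, N, fun v => ⟨hN v, hAN v, hNB v⟩⟩
    exact (hWO.symm.subset ⟨hGO fun v hv => hBG v (hf v hv), fun v hv => hBC v (hf v hv)⟩).1
  choose next N hN using step
  let A : (k : ℕ) → T k := fun k => Nat.rec
    ⟨fun v => {x v}, fun v => isCompact_singleton, fun v => by simpa using hd₀ v, by
      intro f hf
      have : f = x := funext fun v => hf v (mem_univ v)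
      rwa [this]⟩ (fun k A => next k A) k
  have hA0 : ∀ v, x v ∈ (A 0).1 v := fun v => rfl
  have hAs : ∀ k v, (A k).1 v ⊆ N k (A k) v ∧ N k (A k) v ∩ C (d₀ + (k + 1)) ⊆ (A (k + 1)).1 v :=
    fun k v => (hN k (A k) v).2
  have hAmono : ∀ v, Monotone fun k => (A k).1 v := fun v => monotone_nat_of_le_succ fun k y hy =>
    (hAs k v).2 ⟨(hAs k v).1 hy, hmono (by omega) ((A k).2.2.1 v hy)⟩
  refine ⟨univ.pi fun v => ⋃ k, (A k).1 v, fun f hf => ?_, isOpen_set_pi finite_univ fun v _ => ?_,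
    fun v _ => mem_iUnion.2 ⟨0, hA0 v⟩⟩
  · have h : ∀ v, ∃ k, f v ∈ (A k).1 v := fun v => by simpa using hf v (mem_univ v)
    choose k hk using h
    exact (A (Finset.univ.sup k)).2.2.2 fun v _ =>
      hAmono v (Finset.le_sup (Finset.mem_univ v)) (hk v)
  -- The shift by `d` ensures that the ambient compact set of the stage contains `C d`, so that `N`
  -- meets `C d` within the next box.
  · refine hcoh _ fun d => ⟨⋃ k, N (k + d) (A (k + d)) v,
      isOpen_iUnion fun k => (hN _ _ v).1, ?_⟩
    ext y
    simp only [mem_inter_iff, mem_iUnion]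
    refine and_congr_left fun hy => ⟨?_, ?_⟩
    · rintro ⟨k, hk⟩
      exact ⟨k, (hAs _ v).1 (hAmono v (Nat.le_add_right k d) hk)⟩
    · rintro ⟨k, hk⟩
      exact ⟨k + d + 1, (hAs _ v).2 ⟨hk, hmono (by omega) hy⟩⟩

/-- Continuity on a finite power of the colimit of a sequence of compact Hausdorff spaces, each of
which is the image of a compact space. -/
theorem continuous_of_forall_box {S E : Type} [TopologicalSpace S] [T2Space S] [TopologicalSpace E]
    {V : Type} [Finite V] {P : ℕ → Type} [∀ d, TopologicalSpace (P d)] [∀ d, CompactSpace (P d)]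
    (q : ∀ d, P d → S) (hq : ∀ d, Continuous (q d)) (hmono : Monotone fun d => range (q d))
    (hcov : ⋃ d, range (q d) = univ)
    (hcoh : ∀ A : Set S, (∀ d, IsClosed (q d ⁻¹' A)) → IsClosed A)
    (f : (V → S) → E) (hf : ∀ d, Continuous fun p : V → P d => f fun v => q d (p v)) :
    Continuous f := by
  refine ⟨fun U hU => isOpen_of_forall_box _ (fun d => isCompact_range (hq d)) hmono hcov ?_ _ ?_⟩
  · intro U hU
    rw [← isClosed_compl_iff]
    refine hcoh _ fun d => ?_
    obtain ⟨O, hO, h⟩ := hU d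
    have : q d ⁻¹' Uᶜ = q d ⁻¹' Oᶜ := by
      ext p
      have := Set.ext_iff.1 h (q d p)
      simp only [mem_inter_iff, mem_range_self, and_true] at this
      simp [this]
    rw [this]
    exact hO.isClosed_compl.preimage (hq d)
  · intro d
    have hQ : Continuous fun (p : V → P d) v => q d (p v) := by fun_prop
    -- Within the box of `C d`, the part outside the preimage of `U` is the image of a compact set,
    -- hence closed in the whole power.
    refine ⟨((fun (p : V → P d) v => q d (p v)) '' ((fun p => f fun v => q d (p v)) ⁻¹' Uᶜ))ᶜ,
      ((hU.isClosed_compl.preimage (hf d)).isCompact.image hQ).isClosed.isOpen_compl, ?_⟩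
    ext y
    simp only [mem_inter_iff, mem_preimage, mem_compl_iff, mem_image, not_exists, not_and]
    refine and_congr_left fun hy => ⟨?_, ?_⟩
    · rintro h p hp rfl
      exact hp h
    · intro h
      choose p hp using fun v => hy v (mem_univ v)
      by_contra hfy
      exact h p (by simpa [hp] using hfy) (funext hp)

/-! ### Multisets and tuples -/

section Multisets

variable {X : Type}

theorem exists_tuple_of_card {d : ℕ} (s : Multiset X) (hs : Multiset.card s = d) :
    ∃ x : Fin d → X, Finset.univ.val.map x = s := by
  induction s using Quotient.inductionOn with
  | h l =>
    obtain rfl : l.length = d := hs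
    exact ⟨l.get, by rw [Fin.univ_val_map, List.ofFn_get]; rfl⟩

theorem mem_awayFrom {A : Set X} {s : Multiset X} {x : X} : x ∈ awayFrom A s ↔ x ∈ s ∧ x ∉ A := by
  simp [awayFrom]

open Classical in
theorem awayFrom_eq_self {A : Set X} {s : Multiset X} (h : ∀ x ∈ s, x ∉ A) : awayFrom A s = s :=
  Multiset.filter_eq_self.2 h

open Classical in
theorem awayFrom_eq_zero {A : Set X} {s : Multiset X} (h : ∀ x ∈ s, x ∈ A) : awayFrom A s = 0 :=
  Multiset.filter_eq_nil.2 fun x hx h' => h' (h x hx)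

open Classical in
theorem card_awayFrom_le (A : Set X) (s : Multiset X) :
    Multiset.card (awayFrom A s) ≤ Multiset.card s :=
  Multiset.card_le_card (Multiset.filter_le _ _)

open Classical in
theorem awayFrom_cons_of_mem {A : Set X} {x : X} (s : Multiset X) (h : x ∈ A) :
    awayFrom A (x ::ₘ s) = awayFrom A s :=
  Multiset.filter_cons_of_neg (p := (· ∉ A)) s (not_not.2 h)

open Classical in
theorem awayFrom_cons_of_notMem {A : Set X} {x : X} (s : Multiset X) (h : x ∉ A) :
    awayFrom A (x ::ₘ s) = x ::ₘ awayFrom A s :=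
  Multiset.filter_cons_of_pos (p := (· ∉ A)) s h

open Classical in
/-- Every multiset can be padded to a tuple by a given point. -/
theorem exists_padded_tuple {A : Set X} (d : ℕ) (s : Multiset X) (hs : Multiset.card s ≤ d)
    (hA : ∀ x ∈ s, x ∉ A) (b : X) (hb : b ∈ A) :
    ∃ x : Fin d → X, awayFrom A (Finset.univ.val.map x) = s ∧ ∀ k, x k ∈ s ∨ x k = b := by
  obtain ⟨x, hx⟩ := exists_tuple_of_card (s + Multiset.replicate (d - Multiset.card s) b)
    (d := d) (by simp; omega)
  refine ⟨x, ?_, fun k => ?_⟩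
  · rw [hx, awayFrom, Multiset.filter_add, Multiset.filter_eq_self.2 hA, Multiset.filter_eq_nil.2,
      add_zero]
    intro a ha
    rw [Multiset.eq_of_mem_replicate ha]
    exact not_not.2 hb
  · have : x k ∈ Finset.univ.val.map x := Multiset.mem_map_of_mem x (Finset.mem_univ k)
    rw [hx, Multiset.mem_add] at this
    exact this.imp_right Multiset.eq_of_mem_replicate

theorem awayFrom_map {Y : Type} {A : Set X} {B : Set Y} (f : X → Y)
    (h : ∀ x, f x ∈ B ↔ x ∈ A) (s : Multiset X) :
    awayFrom B (s.map f) = (awayFrom A s).map f := by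
  classical
  simp only [awayFrom, Multiset.filter_map]
  congr 1
  exact Multiset.filter_congr fun x _ => not_congr (h x)

end Multisets

/-! ### The collapse of the boundary of the disc -/

theorem Disc.norm_le (z : Disc) : ‖(z : ℂ)‖ ≤ 1 := mem_closedBall_zero_iff.1 z.2

theorem mem_discBoundary {z : Disc} : z ∈ discBoundary ↔ ‖(z : ℂ)‖ = 1 := by simp [discBoundary]

theorem notMem_discBoundary {z : Disc} : z ∉ discBoundary ↔ ‖(z : ℂ)‖ < 1 := by
  rw [mem_discBoundary, lt_iff_le_and_ne, and_iff_right z.norm_le]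

/-- A point of the boundary circle. -/
def Disc.one : Disc := ⟨1, by simp⟩

theorem Disc.one_mem : Disc.one ∈ discBoundary := by simp [mem_discBoundary, Disc.one]

theorem collapse_of_lt {z : Disc} (h : ‖(z : ℂ)‖ < 1) :
    collapse z = ((((1 - ‖(z : ℂ)‖)⁻¹ : ℝ) • (z : ℂ) : ℂ) : OnePoint ℂ) := if_pos h

theorem collapse_of_mem_boundary {z : Disc} (h : z ∈ discBoundary) : collapse z = OnePoint.infty :=
  if_neg (by rw [mem_discBoundary.1 h]; exact lt_irrefl 1)

theorem collapse_mem_infty_iff (z : Disc) :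
    collapse z ∈ ({OnePoint.infty} : Set (OnePoint ℂ)) ↔ z ∈ discBoundary := by
  refine ⟨fun h => ?_, collapse_of_mem_boundary⟩
  by_contra h'
  rw [mem_singleton_iff, collapse_of_lt (notMem_discBoundary.1 h')] at h
  exact OnePoint.coe_ne_infty _ h

/-- The inverse `u ↦ u / (1 + |u|)` of the collapse on the plane. -/
def shrink (u : ℂ) : Disc := ⟨((1 + ‖u‖)⁻¹ : ℝ) • u, by
  rw [mem_closedBall_zero_iff, norm_smul, Real.norm_of_nonneg (by positivity), inv_mul_le_one₀
    (by positivity)]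
  linarith⟩

theorem norm_shrink (u : ℂ) : ‖(shrink u : ℂ)‖ = (1 + ‖u‖)⁻¹ * ‖u‖ := by
  rw [shrink, norm_smul, Real.norm_of_nonneg (by positivity)]

theorem norm_shrink_lt (u : ℂ) : ‖(shrink u : ℂ)‖ < 1 := by
  rw [norm_shrink, inv_mul_lt_one₀ (by positivity)]
  linarith

theorem collapse_shrink (u : ℂ) : collapse (shrink u) = u := by
  rw [collapse_of_lt (norm_shrink_lt u), norm_shrink, shrink, smul_smul]
  have h : (1 - (1 + ‖u‖)⁻¹ * ‖u‖)⁻¹ * (1 + ‖u‖)⁻¹ = 1 := by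
    have : (1 + ‖u‖) ≠ 0 := by positivity
    field_simp
    simp
  rw [h, one_smul]

theorem shrink_collapse {z : Disc} (h : ‖(z : ℂ)‖ < 1) :
    shrink (((1 - ‖(z : ℂ)‖)⁻¹ : ℝ) • (z : ℂ)) = z := by
  ext
  have h' : 0 < 1 - ‖(z : ℂ)‖ := by linarith
  rw [shrink]
  dsimp only
  rw [norm_smul, Real.norm_of_nonneg (by positivity), smul_smul]
  have : (1 + (1 - ‖(z : ℂ)‖)⁻¹ * ‖(z : ℂ)‖)⁻¹ * (1 - ‖(z : ℂ)‖)⁻¹ = 1 := by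
    field_simp
    simp
  rw [this, one_smul]

theorem continuous_shrink : Continuous shrink := by
  refine Continuous.subtype_mk ?_ _
  have : ∀ u : ℂ, 1 + ‖u‖ ≠ 0 := fun u => by positivity
  fun_prop (disch := assumption)

theorem collapse_injOn {z w : Disc} (hz : z ∉ discBoundary) (hw : w ∉ discBoundary)
    (h : collapse z = collapse w) : z = w := by
  rw [notMem_discBoundary] at hz hw
  rw [collapse_of_lt hz, collapse_of_lt hw, OnePoint.coe_eq_coe] at h
  rw [← shrink_collapse hz, h, shrink_collapse hw]

theorem map_collapse_injOn {s t : Multiset Disc} (hs : ∀ z ∈ s, z ∉ discBoundary)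
    (ht : ∀ z ∈ t, z ∉ discBoundary) (h : s.map collapse = t.map collapse) : s = t := by
  have key : ∀ u : Multiset Disc, (∀ z ∈ u, z ∉ discBoundary) →
      (u.map collapse).map (fun w => w.elim Disc.one shrink) = u := fun u hu => by
    rw [Multiset.map_map]
    refine (Multiset.map_congr rfl fun z hz => ?_).trans (Multiset.map_id u)
    have hz' := notMem_discBoundary.1 (hu z hz)
    simpa [collapse_of_lt hz'] using shrink_collapse hz'
  rw [← key s hs, h, key t ht]

theorem collapse_surjective : Function.Surjective collapse := by
  intro w
  induction w using OnePoint.rec with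
  | infty => exact ⟨Disc.one, collapse_of_mem_boundary Disc.one_mem⟩
  | coe u => exact ⟨shrink u, collapse_shrink u⟩

/-- A neighbourhood of infinity has compact complement in the plane, and its preimage is the
complement of the compact image of that set under `shrink`. Other open sets only involve the open
disc, where the formula is continuous. -/
theorem continuous_collapse : Continuous collapse := by
  refine ⟨fun U hU => ?_⟩
  by_cases h : OnePoint.infty ∈ U
  · have hK := ((OnePoint.isOpen_iff_of_mem h).1 hU).2
    have : collapse ⁻¹' U = (shrink '' ((fun u : ℂ => (u : OnePoint ℂ)) ⁻¹' U)ᶜ)ᶜ := by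
      ext z
      rw [mem_compl_iff, mem_preimage, ← not_iff_not, not_not]
      constructor
      · intro hz
        have hz' : ‖(z : ℂ)‖ < 1 := by
          by_contra h'
          exact hz (by rwa [collapse, if_neg h'])
        exact ⟨_, by rwa [collapse_of_lt hz'] at hz, shrink_collapse hz'⟩
      · rintro ⟨u, hu, rfl⟩
        rwa [collapse_shrink]
    rw [this]
    exact (hK.image continuous_shrink).isClosed.isOpen_compl
  · have hV := (OnePoint.isOpen_iff_of_notMem h).1 hU
    have hlt : IsOpen {z : Disc | ‖(z : ℂ)‖ < 1} := isOpen_lt (by fun_prop) continuous_const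
    have hc : ContinuousOn (fun z : Disc => (((1 - ‖(z : ℂ)‖)⁻¹ : ℝ) • (z : ℂ)))
        {z : Disc | ‖(z : ℂ)‖ < 1} := by
      have : ∀ z ∈ {z : Disc | ‖(z : ℂ)‖ < 1}, 1 - ‖(z : ℂ)‖ ≠ 0 := fun z hz =>
        (sub_pos.2 hz).ne'
      refine ContinuousOn.smul (ContinuousOn.inv₀ (by fun_prop) this) (by fun_prop)
    convert! hc.isOpen_inter_preimage hlt hV using 1
    ext z
    by_cases hz : ‖(z : ℂ)‖ < 1
    · simp [hz, collapse_of_lt hz]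
    · simp [hz, collapse, h]

/-! ### The infinite symmetric product of the sphere -/

theorem SPInf.points_injective {X : Type} {A : Set X} :
    Function.Injective (SPInf.points : SPInf X A → Multiset X) := by
  rintro ⟨a⟩ ⟨b⟩ h
  exact Quotient.sound h

/-- The configuration in the sphere given by a tuple of points of the disc. -/
def sphereOfTuple (p : (d : ℕ+) × (Fin d → Disc)) : SPSphere :=
  Quotient.mk (spSetoid _ _) ⟨p.1, Quotient.mk (permSetoid _ _) (collapse ∘ p.2)⟩

theorem points_sphereOfTuple (p : (d : ℕ+) × (Fin d → Disc)) : (sphereOfTuple p).points =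
    (awayFrom discBoundary (Finset.univ.val.map p.2)).map collapse := by
  rw [← awayFrom_map collapse collapse_mem_infty_iff, Multiset.map_map]
  rfl

theorem isQuotientMap_sigmaMap {ι : Type} {X Y : ι → Type} [∀ i, TopologicalSpace (X i)]
    [∀ i, TopologicalSpace (Y i)] {f : ∀ i, X i → Y i} (h : ∀ i, IsQuotientMap (f i)) :
    IsQuotientMap (Sigma.map id f) := by
  rw [isQuotientMap_iff]
  refine ⟨?_, Function.surjective_id.sigma_map fun i => (h i).surjective⟩
  rw [isCoinducing_iff]
  intro s
  rw [isOpen_sigma_iff, isOpen_sigma_iff]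
  exact forall_congr' fun i => (h i).isOpen_preimage (s := Sigma.mk i ⁻¹' s)

/-- Powers of the disc map onto powers of the sphere as compact spaces onto Hausdorff ones, hence by
quotient maps. The topology of `SP^∞` is thereby reduced to compact powers of the disc. -/
theorem isQuotientMap_sphereOfTuple : IsQuotientMap sphereOfTuple := by
  have h₁ : IsQuotientMap (Sigma.map id fun (d : ℕ+) (x : Fin d → Disc) => collapse ∘ x) :=
    isQuotientMap_sigmaMap (Y := fun d : ℕ+ => Fin d → OnePoint ℂ) fun d =>
      IsQuotientMap.of_surjective_continuous
      collapse_surjective.comp_left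
      (by
        have := continuous_collapse
        fun_prop)
  have h₂ : IsQuotientMap (Sigma.map id fun (d : ℕ+) (x : Fin d → OnePoint ℂ) =>
      (Quotient.mk (permSetoid d _) x : SP d (OnePoint ℂ))) :=
    isQuotientMap_sigmaMap (Y := fun d : ℕ+ => SP d (OnePoint ℂ)) fun d =>
      isQuotientMap_quotient_mk' (s := permSetoid d (OnePoint ℂ))
  exact (isQuotientMap_quotient_mk' (s := spSetoid (OnePoint ℂ) {OnePoint.infty})).comp
    (h₂.comp h₁)

theorem exists_sphere_of_tuple_le (w : SPSphere) (d : ℕ+) (h : Multiset.card w.points ≤ d) :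
    ∃ x : Fin d → Disc, sphereOfTuple ⟨d, x⟩ = w := by
  obtain ⟨⟨e, y⟩, rfl⟩ := isQuotientMap_sphereOfTuple.surjective w
  rw [points_sphereOfTuple, Multiset.card_map] at h
  obtain ⟨x, hx, -⟩ := exists_padded_tuple d _ h (fun z hz => (mem_awayFrom.1 hz).2) Disc.one
    Disc.one_mem
  refine ⟨x, SPInf.points_injective ?_⟩
  rw [points_sphereOfTuple, points_sphereOfTuple, hx]

/-- Every finite configuration in the open disc gives one in the sphere. -/
theorem exists_sphere_of_points (s : Multiset Disc) (hs : ∀ z ∈ s, z ∉ discBoundary) :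
    ∃ w : SPSphere, w.points = s.map collapse := by
  obtain ⟨x, hx, -⟩ := exists_padded_tuple (Multiset.card s).succPNat s (Nat.le_succ _) hs
    Disc.one Disc.one_mem
  exact ⟨sphereOfTuple ⟨_, x⟩, by
    rw [points_sphereOfTuple, hx]⟩

/-- The empty configuration in the sphere. -/
def emptySphere : SPSphere := sphereOfTuple ⟨1, fun _ => Disc.one⟩

theorem points_emptySphere : emptySphere.points = 0 := by
  rw [emptySphere, points_sphereOfTuple, awayFrom_eq_zero, Multiset.map_zero]
  intro z hz
  obtain ⟨_, -, rfl⟩ := Multiset.mem_map.1 hz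
  exact Disc.one_mem

theorem points_eq_zero_iff {w : SPSphere} : w.points = 0 ↔ w = emptySphere :=
  ⟨fun h => SPInf.points_injective (h.trans points_emptySphere.symm), fun h => h ▸ points_emptySphere⟩

/-! ### Infinite complex projective space is Hausdorff -/

theorem extendZero_of_lt {N : ℕ} (v : Fin (N + 1) → ℂ) {k : ℕ} (h : k < N + 1) :
    extendZero v k = v ⟨k, h⟩ := dif_pos h

theorem extendZero_of_le {N : ℕ} (v : Fin (N + 1) → ℂ) {k : ℕ} (h : N + 1 ≤ k) :
    extendZero v k = 0 := dif_neg (by omega)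

theorem sum_norm_extendZero {N M : ℕ} (v : Fin (N + 1) → ℂ) (h : N + 1 ≤ M) :
    ∑ k ∈ Finset.range M, ‖extendZero v k‖ ^ 2 = ∑ k, ‖v k‖ ^ 2 := by
  rw [← Finset.sum_subset (Finset.range_subset_range.2 h), Finset.sum_range]
  · exact Finset.sum_congr rfl fun k _ => by rw [extendZero_of_lt v k.2]
  · intro k _ hk
    rw [extendZero_of_le v (by simpa using hk)]
    simp

theorem exists_extendZero_ne_zero {N : ℕ} {v : Fin (N + 1) → ℂ} (hv : v ≠ 0) :
    ∃ k, extendZero v k ≠ 0 := by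
  obtain ⟨k, hk⟩ := Function.ne_iff.1 hv
  exact ⟨k, by rwa [extendZero_of_lt v k.2]⟩

theorem sum_norm_pos {N : ℕ} {v : Fin (N + 1) → ℂ} (hv : v ≠ 0) : 0 < ∑ k, ‖v k‖ ^ 2 := by
  obtain ⟨k, hk⟩ := Function.ne_iff.1 hv
  exact Finset.sum_pos' (fun _ _ => by positivity)
    ⟨k, Finset.mem_univ k, by have := norm_pos_iff.2 hk; positivity⟩

/-- The function `v_i conj(v_j) / |v|²` on projective space. -/
def CPInf.matrixCoeff (i j : ℕ) : CPInf → ℂ :=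
  Quotient.lift (s := cpSetoid)
    (fun p => extendZero p.2.1 i * star (extendZero p.2.1 j) / ((∑ k, ‖p.2.1 k‖ ^ 2 : ℝ) : ℂ)) (by
      rintro ⟨N, v, hv⟩ ⟨M, w, hw⟩ ⟨c, hc, h⟩
      dsimp only at h ⊢
      -- Two representatives may have different lengths, so both norms are summed over a common
      -- range.
      rw [← sum_norm_extendZero v (le_max_left (N + 1) (M + 1)),
        ← sum_norm_extendZero w (le_max_right (N + 1) (M + 1))]
      simp only [h, norm_mul, mul_pow, ← Finset.mul_sum, star_mul']
      have h₁ : (((‖c‖ ^ 2 * ∑ k ∈ Finset.range (max (N + 1) (M + 1)), ‖extendZero v k‖ ^ 2 : ℝ)) : ℂ)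
          = c * star c *
            ((∑ k ∈ Finset.range (max (N + 1) (M + 1)), ‖extendZero v k‖ ^ 2 : ℝ) : ℂ) := by
        rw [Complex.ofReal_mul, Complex.ofReal_pow]
        congr 1
        exact (Complex.mul_conj' c).symm
      rw [h₁, mul_mul_mul_comm, mul_div_mul_left]
      exact mul_ne_zero hc (star_ne_zero.2 hc))

theorem continuous_extendZero {N : ℕ} (k : ℕ) :
    Continuous fun v : Fin (N + 1) → ℂ => extendZero v k := by
  by_cases h : k < N + 1
  · simp only [extendZero_of_lt _ h]
    fun_prop
  · simp only [extendZero_of_le _ (not_lt.1 h)]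
    fun_prop

theorem CPInf.continuous_mk (N : ℕ) : Continuous fun v : {v : Fin (N + 1) → ℂ // v ≠ 0} =>
    (Quotient.mk cpSetoid ⟨N, v⟩ : CPInf) :=
  continuous_quot_mk.comp (continuous_sigmaMk
    (σ := fun N : ℕ => {v : Fin (N + 1) → ℂ // v ≠ 0}))

theorem CPInf.continuous_matrixCoeff (i j : ℕ) : Continuous (CPInf.matrixCoeff i j) := by
  refine Continuous.quotient_lift (continuous_sigma fun N => ?_) _
  have h : ∀ k, Continuous fun v : {v : Fin (N + 1) → ℂ // v ≠ 0} => extendZero v.1 k :=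
    fun k => (continuous_extendZero k).comp continuous_subtype_val
  have hn : Continuous fun v : {v : Fin (N + 1) → ℂ // v ≠ 0} => ∑ k, ‖v.1 k‖ ^ 2 :=
    continuous_finsetSum _ fun k _ => (((continuous_apply k).comp continuous_subtype_val).norm).pow 2
  refine ((h i).mul (h j).star).div (Complex.continuous_ofReal.comp hn) fun v => ?_
  exact_mod_cast (sum_norm_pos v.2).ne'

/-- The coefficients are the entries of the orthogonal projection onto the line. Its column `j` is a
multiple of `v`, nonzero when `v_j ≠ 0`, and so determines the line. -/
theorem CPInf.eq_of_matrixCoeff {p q : CPInf}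
    (h : ∀ i j, CPInf.matrixCoeff i j p = CPInf.matrixCoeff i j q) : p = q := by
  obtain ⟨⟨N, v, hv⟩, rfl⟩ := Quotient.exists_rep p
  obtain ⟨⟨M, w, hw⟩, rfl⟩ := Quotient.exists_rep q
  obtain ⟨j, hj⟩ := exists_extendZero_ne_zero hv
  have hv' : ((∑ k, ‖v k‖ ^ 2 : ℝ) : ℂ) ≠ 0 := by exact_mod_cast (sum_norm_pos hv).ne'
  have hw' : ((∑ k, ‖w k‖ ^ 2 : ℝ) : ℂ) ≠ 0 := by exact_mod_cast (sum_norm_pos hw).ne'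
  have h' : ∀ i, extendZero v i * star (extendZero v j) / ((∑ k, ‖v k‖ ^ 2 : ℝ) : ℂ) =
      extendZero w i * star (extendZero w j) / ((∑ k, ‖w k‖ ^ 2 : ℝ) : ℂ) := fun i => h i j
  have hwj : extendZero w j ≠ 0 := by
    intro h0
    have := h' j
    rw [h0, zero_mul, zero_div, div_eq_zero_iff, mul_eq_zero, star_eq_zero] at this
    tauto
  refine Quotient.sound ⟨star (extendZero v j) / ((∑ k, ‖v k‖ ^ 2 : ℝ) : ℂ) *
    (((∑ k, ‖w k‖ ^ 2 : ℝ) : ℂ) / star (extendZero w j)), ?_, fun i => ?_⟩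
  · exact mul_ne_zero (div_ne_zero (star_ne_zero.2 hj) hv')
      (div_ne_zero hw' (star_ne_zero.2 hwj))
  · have h₁ := h' i
    have h₂ := star_ne_zero.2 hwj
    dsimp only
    rw [mul_comm _ (extendZero v i), ← mul_assoc, ← mul_div_assoc, ← mul_div_assoc (extendZero v i), h₁]
    field_simp

instance : T2Space CPInf :=
  T2Space.of_injective_continuous (f := fun p (a : ℕ × ℕ) => CPInf.matrixCoeff a.1 a.2 p)
    (fun _ _ h => CPInf.eq_of_matrixCoeff fun i j => congrFun h (i, j))
    (continuous_pi fun a => CPInf.continuous_matrixCoeff a.1 a.2)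

/-! ### Configurations as roots of polynomials -/

open Polynomial in
/-- The linear polynomial whose root is the image of `z` in the sphere. -/
def discFactor (z : Disc) : ℂ[X] := C ((1 - ‖(z : ℂ)‖ : ℝ) : ℂ) * X - C (z : ℂ)

open Polynomial in
-- On the boundary the linear term disappears and a nonzero constant remains: a root at infinity
-- only changes the polynomial by a scalar.
theorem discFactor_of_mem {z : Disc} (h : z ∈ discBoundary) : discFactor z = C (-(z : ℂ)) := by
  simp [discFactor, mem_discBoundary.1 h]

theorem Disc.ne_zero {z : Disc} (h : z ∈ discBoundary) : (z : ℂ) ≠ 0 := by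
  rw [← norm_ne_zero_iff, mem_discBoundary.1 h]
  exact one_ne_zero

theorem one_sub_norm_ne_zero {z : Disc} (h : z ∉ discBoundary) : ((1 - ‖(z : ℂ)‖ : ℝ) : ℂ) ≠ 0 := by
  have := notMem_discBoundary.1 h
  exact_mod_cast (sub_pos.2 this).ne'

open Polynomial in
theorem discFactor_ne_zero (z : Disc) : discFactor z ≠ 0 := by
  by_cases h : z ∈ discBoundary
  · rw [discFactor_of_mem h]
    exact C_ne_zero.2 (neg_ne_zero.2 (Disc.ne_zero h))
  · intro h0
    have := congrArg (coeff · 1) h0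
    simp [discFactor, coeff_C] at this
    exact one_sub_norm_ne_zero h (by push_cast; exact this)

open Polynomial in
theorem natDegree_discFactor_le (z : Disc) : (discFactor z).natDegree ≤ 1 := by
  rw [discFactor, sub_eq_add_neg, ← C_neg]
  exact natDegree_linear_le

open Polynomial in
theorem roots_discFactor (z : Disc) : (discFactor z).roots.map (fun u : ℂ => (u : OnePoint ℂ)) =
    (awayFrom discBoundary {z}).map collapse := by
  classical
  by_cases h : z ∈ discBoundary
  · rw [discFactor_of_mem h, roots_C, awayFrom_eq_zero (by simpa using h)]
    rfl
  · rw [awayFrom_eq_self (by simpa using h), discFactor,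
      roots_C_mul_X_sub_C _ (one_sub_norm_ne_zero h), Multiset.map_singleton,
      Multiset.map_singleton, collapse_of_lt (notMem_discBoundary.1 h), Complex.real_smul,
      Complex.ofReal_inv]

open Polynomial in
/-- The polynomial whose roots are the points of a configuration outside the boundary. -/
def configPoly (s : Multiset Disc) : ℂ[X] := (s.map discFactor).prod

theorem configPoly_tuple {d : ℕ} (x : Fin d → Disc) :
    configPoly (Finset.univ.val.map x) = ∏ i, discFactor (x i) := by
  rw [configPoly, Multiset.map_map]
  rfl

theorem configPoly_ne_zero (s : Multiset Disc) : configPoly s ≠ 0 := by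
  refine Multiset.prod_ne_zero fun h => ?_
  obtain ⟨z, -, hz⟩ := Multiset.mem_map.1 h
  exact discFactor_ne_zero z hz

theorem natDegree_configPoly_le (s : Multiset Disc) :
    (configPoly s).natDegree ≤ Multiset.card s := by
  refine (Polynomial.natDegree_multiset_prod_le _).trans ?_
  rw [Multiset.map_map]
  refine (Multiset.sum_le_card_nsmul _ 1 ?_).trans (by simp)
  intro n hn
  obtain ⟨z, -, rfl⟩ := Multiset.mem_map.1 hn
  exact natDegree_discFactor_le z

theorem roots_configPoly (s : Multiset Disc) :
    (configPoly s).roots.map (fun u : ℂ => (u : OnePoint ℂ)) =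
      (awayFrom discBoundary s).map collapse := by
  classical
  induction s using Multiset.induction_on with
  | empty => simp [configPoly, awayFrom]
  | cons z s ih =>
    have h : configPoly (z ::ₘ s) = discFactor z * configPoly s := by simp [configPoly]
    rw [h, Polynomial.roots_mul (mul_ne_zero (discFactor_ne_zero z) (configPoly_ne_zero s)),
      Multiset.map_add, ih, roots_discFactor, ← Multiset.map_add, ← Multiset.singleton_add]
    simp only [awayFrom, Multiset.filter_add]

open Polynomial in
-- Over `ℂ` a polynomial is its leading coefficient times the product of its root factors, so the
-- scalar is the quotient of the leading coefficients.
theorem exists_eq_C_mul_iff {p q : ℂ[X]} (hp : p ≠ 0) (hq : q ≠ 0) :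
    (∃ c : ℂ, c ≠ 0 ∧ ∀ k, q.coeff k = c * p.coeff k) ↔ p.roots = q.roots := by
  constructor
  · rintro ⟨c, hc, h⟩
    have : q = C c * p := by ext k; rw [h, coeff_C_mul]
    rw [this, roots_C_mul _ hc]
  · intro h
    refine ⟨q.leadingCoeff / p.leadingCoeff,
      div_ne_zero (leadingCoeff_ne_zero.2 hq) (leadingCoeff_ne_zero.2 hp), fun k => ?_⟩
    have h₁ := (IsAlgClosed.splits p).eq_prod_roots
    have h₂ := (IsAlgClosed.splits q).eq_prod_roots
    rw [← h] at h₂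
    have h₃ := leadingCoeff_ne_zero.2 hp
    conv_lhs => rw [h₂, coeff_C_mul]
    conv_rhs => rw [h₁, leadingCoeff_mul, coeff_C_mul]
    rw [(monic_multiset_prod_of_monic _ _ fun a _ => monic_X_sub_C a).leadingCoeff, leadingCoeff_C]
    field_simp

open Polynomial in
theorem extendZero_coeff {N : ℕ} (p : ℂ[X]) (h : p.natDegree ≤ N) (k : ℕ) :
    extendZero (fun i : Fin (N + 1) => p.coeff i) k = p.coeff k := by
  by_cases hk : k < N + 1
  · rw [extendZero_of_lt _ hk]
  · rw [extendZero_of_le _ (not_lt.1 hk), coeff_eq_zero_of_natDegree_lt (by omega)]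

open Polynomial in
/-- The point of projective space given by the coefficients of a polynomial. -/
def CPInf.ofPoly (N : ℕ) (p : ℂ[X]) (h : p.natDegree ≤ N) (hp : p ≠ 0) : CPInf :=
  Quotient.mk cpSetoid ⟨N, fun i => p.coeff i, fun h0 => hp (by
    ext k
    rw [← extendZero_coeff p h, h0, extendZero]
    split_ifs <;> rfl)⟩

open Polynomial in
theorem CPInf.ofPoly_eq_iff {N M : ℕ} {p q : ℂ[X]} {h : p.natDegree ≤ N} {hp : p ≠ 0}
    {h' : q.natDegree ≤ M} {hq : q ≠ 0} :
    CPInf.ofPoly N p h hp = CPInf.ofPoly M q h' hq ↔ p.roots = q.roots := by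
  rw [← exists_eq_C_mul_iff hp hq]
  refine Quotient.eq.trans ?_
  refine exists_congr fun c => and_congr_right fun _ => forall_congr' fun k => ?_
  rw [← extendZero_coeff p h, ← extendZero_coeff q h']

open Polynomial in
theorem CPInf.exists_ofPoly {N : ℕ} (v : {v : Fin (N + 1) → ℂ // v ≠ 0}) :
    ∃ (p : ℂ[X]) (h : p.natDegree ≤ N) (hp : p ≠ 0),
      CPInf.ofPoly N p h hp = Quotient.mk cpSetoid ⟨N, v⟩ := by
  have hc : ∀ i : Fin (N + 1), (ofFn (N + 1) v.1).coeff i = v.1 i := fun i =>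
    ofFn_coeff_eq_val_of_lt v.1 i.2
  refine ⟨ofFn (N + 1) v.1, Nat.lt_succ_iff.1 (ofFn_natDegree_lt (by omega) v.1), fun h0 => v.2 ?_,
    ?_⟩
  · ext i
    rw [← hc, h0, coeff_zero]
    rfl
  · rw [CPInf.ofPoly]
    congr 3
    exact funext hc

/-! ### The infinite symmetric product of the sphere is projective space -/

/-- The point of projective space given by a tuple of points of the disc. -/
def cpOfTuple (p : (d : ℕ+) × (Fin d → Disc)) : CPInf :=
  CPInf.ofPoly p.1 (configPoly (Finset.univ.val.map p.2))
    ((natDegree_configPoly_le _).trans (by simp)) (configPoly_ne_zero _)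

theorem cpOfTuple_eq_iff (a b : (d : ℕ+) × (Fin d → Disc)) :
    cpOfTuple a = cpOfTuple b ↔ sphereOfTuple a = sphereOfTuple b := by
  rw [cpOfTuple, cpOfTuple, CPInf.ofPoly_eq_iff,
    ← (Multiset.map_injective (OnePoint.coe_injective (X := ℂ))).eq_iff, roots_configPoly,
    roots_configPoly, ← points_sphereOfTuple, ← points_sphereOfTuple,
    SPInf.points_injective.eq_iff]

open Polynomial in
theorem continuous_coeff_prod {Y ι : Type} [TopologicalSpace Y] (s : Finset ι) (f : ι → Y → ℂ[X])
    (h : ∀ i ∈ s, ∀ k, Continuous fun y => (f i y).coeff k) (k : ℕ) :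
    Continuous fun y => (∏ i ∈ s, f i y).coeff k := by
  have := Finset.prod_induction f (fun g => ∀ k, Continuous fun y => (g y).coeff k)
    (fun a b ha hb k => by
      simp only [Pi.mul_apply, coeff_mul]
      exact continuous_finsetSum _ fun x _ => (ha _).mul (hb _))
    (fun k => continuous_const (y := (1 : ℂ[X]).coeff k)) h k
  simpa only [Finset.prod_apply] using this

open Polynomial in
theorem continuous_cpOfTuple : Continuous cpOfTuple := by
  refine continuous_sigma fun d => ?_
  refine (CPInf.continuous_mk d).comp ?_
  refine continuous_induced_rng.2 (continuous_pi fun k => ?_)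
  change Continuous fun x : Fin d → Disc => (configPoly (Finset.univ.val.map x)).coeff k
  simp only [configPoly_tuple]
  refine continuous_coeff_prod Finset.univ (fun i (x : Fin d → Disc) => discFactor (x i))
    (fun i _ k => ?_) k
  simp only [discFactor, coeff_sub, coeff_C_mul, coeff_C, coeff_X]
  split_ifs <;> fun_prop

/-- This is the fundamental theorem of algebra. There are at most `N` roots, and unused slots are
filled by a boundary point; taking `N + 1` slots keeps the degree positive when `N = 0`. -/
theorem exists_cpOfTuple {N : ℕ} (v : {v : Fin (N + 1) → ℂ // v ≠ 0}) :
    ∃ x : Fin N.succPNat → Disc,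
      cpOfTuple ⟨_, x⟩ = Quotient.mk cpSetoid ⟨N, v⟩ := by
  obtain ⟨p, h, hp, hv⟩ := CPInf.exists_ofPoly v
  have hcard : Multiset.card (p.roots.map shrink) ≤ N.succPNat := by
    rw [Multiset.card_map]
    exact (p.card_roots'.trans h).trans N.le_succ
  obtain ⟨x, hx, -⟩ := exists_padded_tuple N.succPNat (p.roots.map shrink) hcard (by
    intro z hz
    obtain ⟨u, -, rfl⟩ := Multiset.mem_map.1 hz
    exact notMem_discBoundary.2 (norm_shrink_lt u)) Disc.one Disc.one_mem
  refine ⟨x, ?_⟩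
  rw [← hv, cpOfTuple, CPInf.ofPoly_eq_iff,
    ← (Multiset.map_injective (OnePoint.coe_injective (X := ℂ))).eq_iff, roots_configPoly]
  dsimp only at hx ⊢
  rw [hx, Multiset.map_map]
  exact Multiset.map_congr rfl fun u _ => collapse_shrink u

theorem isQuotientMap_cpOfTuple : IsQuotientMap cpOfTuple := by
  refine isQuotientMap_iff_isClosed.2 ⟨?_, fun A => ⟨fun h => h.preimage continuous_cpOfTuple, ?_⟩⟩
  · intro p
    obtain ⟨⟨N, v⟩, rfl⟩ := Quotient.exists_rep p
    obtain ⟨x, hx⟩ := exists_cpOfTuple v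
    exact ⟨_, hx⟩
  · intro hA
    refine (isQuotientMap_quotient_mk' (s := cpSetoid)).isClosed_preimage.1
      (isClosed_sigma_iff.2 fun N => ?_)
    -- All points represented by vectors of length `N + 1` already come from one compact power of
    -- the disc, and images of its closed subsets are closed because `ℂP^∞` is Hausdorff.
    let R : (Fin N.succPNat → Disc) → CPInf := fun x => cpOfTuple ⟨_, x⟩
    have hR : Continuous R := continuous_cpOfTuple.comp
      (continuous_sigmaMk (σ := fun d : ℕ+ => Fin d → Disc) (i := N.succPNat))
    have hRA : IsClosed (R ⁻¹' A) := isClosed_sigma_iff.1 hA N.succPNat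
    have hcl : IsClosed (R '' (R ⁻¹' A)) := (hRA.isCompact.image hR).isClosed
    convert! hcl.preimage (CPInf.continuous_mk N) using 1
    ext v
    constructor
    · intro hv
      obtain ⟨x, hx⟩ := exists_cpOfTuple v
      exact ⟨x, (congrArg (· ∈ A) hx).mpr hv, hx⟩
    · rintro ⟨x, hx, hxv⟩
      exact (congrArg (· ∈ A) hxv).mp hx

theorem exists_sphere_homeomorph : ∃ h : SPSphere ≃ₜ CPInf, ∀ a, h (sphereOfTuple a) = cpOfTuple a := by
  let q : C((d : ℕ+) × (Fin d → Disc), SPSphere) := ⟨_, isQuotientMap_sphereOfTuple.continuous⟩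
  let c : C((d : ℕ+) × (Fin d → Disc), CPInf) := ⟨_, continuous_cpOfTuple⟩
  have hq : IsQuotientMap q := isQuotientMap_sphereOfTuple
  have hc : IsQuotientMap c := isQuotientMap_cpOfTuple
  have hqc : Function.FactorsThrough c q := fun a b h => (cpOfTuple_eq_iff a b).2 h
  have hcq : Function.FactorsThrough q c := fun a b h => (cpOfTuple_eq_iff a b).1 h
  have h₁ : ∀ a, hq.lift c hqc (q a) = c a := fun a =>
    DFunLike.congr_fun (hq.lift_comp c hqc) a
  have h₂ : ∀ a, hc.lift q hcq (c a) = q a := fun a =>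
    DFunLike.congr_fun (hc.lift_comp q hcq) a
  refine ⟨⟨⟨hq.lift c hqc, hc.lift q hcq, fun w => ?_, fun w => ?_⟩, ContinuousMap.continuous _,
    ContinuousMap.continuous _⟩, h₁⟩
  · obtain ⟨a, rfl⟩ := hq.surjective w
    rw [h₁, h₂]
  · obtain ⟨a, rfl⟩ := hc.surjective w
    rw [h₂, h₁]

theorem cpOfTuple_base : cpOfTuple ⟨1, fun _ => Disc.one⟩ = CPInf.base := by
  have h : configPoly (Finset.univ.val.map fun _ : Fin ((1 : ℕ+) : ℕ) => Disc.one) =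
      Polynomial.C (-1) := by
    have : discFactor Disc.one = Polynomial.C (-1) := discFactor_of_mem Disc.one_mem
    have h1 : Multiset.card (Finset.univ.val : Multiset (Fin ((1 : ℕ+) : ℕ))) = 1 := rfl
    rw [configPoly, Multiset.map_const', h1, Multiset.map_replicate, this,
      Multiset.prod_replicate, pow_one]
  refine Quotient.sound ⟨-1, by simp, fun k => ?_⟩
  have h' := extendZero_coeff (N := (1 : ℕ+)) (configPoly (Finset.univ.val.map
    fun _ : Fin ((1 : ℕ+) : ℕ) => Disc.one)) (by rw [h, Polynomial.natDegree_C]; exact Nat.zero_le _) k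
  refine Eq.trans ?_ (congrArg (-1 * ·) h'.symm)
  rw [h]
  rcases k with _ | k <;> simp [extendZero, Polynomial.coeff_one]

theorem exists_based_sphere_homeomorph :
    ∃ h : SPSphere ≃ₜ CPInf, ∀ w, w.points = 0 ↔ h w = CPInf.base := by
  obtain ⟨h, hh⟩ := exists_sphere_homeomorph
  refine ⟨h, fun w => ?_⟩
  rw [points_eq_zero_iff, ← cpOfTuple_base, ← hh, h.injective.eq_iff]
  rfl

instance : T2Space SPSphere := by
  obtain ⟨h, -⟩ := exists_based_sphere_homeomorph
  exact h.symm.t2Space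

/-! ### Configuration spaces as quotients of spaces of tuples -/

/-- The saturation of an open set is the union of its translates by permutations. Open quotient
maps, unlike general ones, survive finite products and restriction to the preimage of a subset. -/
theorem isOpenQuotientMap_permSetoid (d : ℕ) (X : Type) [TopologicalSpace X] :
    IsOpenQuotientMap (Quotient.mk (permSetoid d X) : (Fin d → X) → SP d X) := by
  refine ⟨Quotient.mk_surjective, continuous_quot_mk, fun U hU => ?_⟩
  refine (isQuotientMap_quotient_mk' (s := permSetoid d X)).isOpen_preimage.1 ?_
  have : Quotient.mk (permSetoid d X) ⁻¹' (Quotient.mk (permSetoid d X) '' U) =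
      ⋃ g : Equiv.Perm (Fin d), (fun x : Fin d → X => x ∘ g) ⁻¹' U := by
    ext x
    simp only [mem_preimage, mem_image, mem_iUnion]
    constructor
    · rintro ⟨y, hy, h⟩
      obtain ⟨g, rfl⟩ := Quotient.exact h.symm
      exact ⟨g, hy⟩
    · rintro ⟨g, hg⟩
      exact ⟨x ∘ g, hg, Quotient.sound ((permSetoid d X).symm ⟨g, rfl⟩)⟩
  exact this ▸ isOpen_iUnion fun g => hU.preimage (by fun_prop)

/-- No point belongs to all the sets with indices in `σ × [n]`, for any non-face `σ`. -/
def NoCommonPoint {r n : ℕ} {X : Type} (K : Set (Finset (Fin r))) (P : Fin r → Fin n → Set X) :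
    Prop :=
  ∀ σ : Finset (Fin r), σ ∉ K → ¬ ∃ x : X, ∀ i ∈ σ, ∀ j : Fin n, x ∈ P i j

theorem NoCommonPoint.mono {r n : ℕ} {X : Type} {K : Set (Finset (Fin r))}
    {P Q : Fin r → Fin n → Set X} (h : NoCommonPoint K P) (hQ : ∀ i j, Q i j ⊆ P i j) :
    NoCommonPoint K Q :=
  fun σ hσ ⟨x, hx⟩ => h σ hσ ⟨x, fun i hi j => hQ i j (hx i hi j)⟩

section Conf

variable {r n : ℕ} {K : Set (Finset (Fin r))}

/-- Tuples of points of the disc, of degrees `D`, without common points for non-faces. -/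
abbrev TupleConf (K : Set (Finset (Fin r))) (n : ℕ) (D : Fin r → ℕ+) : Type :=
  {x : (i : Fin r) → Fin n → Fin (D i) → Disc // NoCommonPoint K fun i j => range (x i j)}

/-- The bad tuples for one `σ` are the projection of a closed set of pairs (tuple, common point),
and projection along the compact disc is closed. -/
theorem isOpen_noCommonPoint (D : Fin r → ℕ+) : IsOpen
    {x : (i : Fin r) → Fin n → Fin (D i) → Disc | NoCommonPoint K fun i j => range (x i j)} := by
  have : {x : (i : Fin r) → Fin n → Fin (D i) → Disc | NoCommonPoint K fun i j => range (x i j)} =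
      ⋂ σ : {σ : Finset (Fin r) // σ ∉ K}, (Prod.fst '' ⋂ i ∈ σ.1, ⋂ j, ⋃ k,
        {p : ((i : Fin r) → Fin n → Fin (D i) → Disc) × Disc | p.1 i j k = p.2})ᶜ := by
    ext x
    simp [NoCommonPoint]
  rw [this]
  refine isOpen_iInter_of_finite fun σ => (isClosedMap_fst_of_compactSpace _ ?_).isOpen_compl
  refine isClosed_biInter fun i _ => isClosed_iInter fun j => isClosed_iUnion_of_finite fun k => ?_
  exact isClosed_eq (by fun_prop) continuous_snd

theorem mem_toMultiset_iff_mem_range {X : Type} {d : ℕ} {x : Fin d → X} {z : X} :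
    z ∈ Finset.univ.val.map x ↔ z ∈ range x := by
  simp

/-- The configuration given by a tuple. -/
def confOfTuple (p : (D : Fin r → ℕ+) × TupleConf K n D) : DiscConf K n :=
  Quotient.mk (confSetoid K n Disc discBoundary)
    ⟨p.1, ⟨fun i j => Quotient.mk (permSetoid _ _) (p.2.1 i j), fun σ hσ ⟨z, hz⟩ =>
      p.2.2 σ hσ ⟨z, fun i hi j => mem_toMultiset_iff_mem_range.1 (hz i hi j)⟩⟩⟩

theorem points_confOfTuple (p : (D : Fin r → ℕ+) × TupleConf K n D) (i : Fin r) (j : Fin n) :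
    (confOfTuple p).points i j = awayFrom discBoundary (Finset.univ.val.map (p.2.1 i j)) := rfl

theorem isQuotientMap_confOfTuple :
    IsQuotientMap (confOfTuple : ((D : Fin r → ℕ+) × TupleConf K n D) → DiscConf K n) := by
  have h : ∀ D : Fin r → ℕ+, IsQuotientMap fun x : TupleConf K n D =>
      (⟨fun i j => Quotient.mk (permSetoid _ _) (x.1 i j), fun σ hσ ⟨z, hz⟩ =>
        x.2 σ hσ ⟨z, fun i hi j => mem_toMultiset_iff_mem_range.1 (hz i hi j)⟩⟩ :
          ConfD K n Disc D) := by
    intro D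
    have h₁ : IsOpenQuotientMap (Pi.map fun i : Fin r => Pi.map fun _ : Fin n =>
        (Quotient.mk (permSetoid (D i) Disc) : (Fin (D i) → Disc) → SP (D i) Disc)) :=
      IsOpenQuotientMap.piMap fun i => IsOpenQuotientMap.piMap fun j =>
        isOpenQuotientMap_permSetoid (D i) Disc
    have h₂ := (h₁.restrictPreimage {ξ : (i : Fin r) → Fin n → SP (D i) Disc | ∀ σ : Finset (Fin r), σ ∉ K →
      ¬ ∃ z : Disc, ∀ i ∈ σ, ∀ j : Fin n, z ∈ (ξ i j).toMultiset}).isQuotientMap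
    let e : TupleConf K n D ≃ₜ _ := Homeomorph.subtype (Homeomorph.refl _)
      (q := fun x => x ∈ (Pi.map fun i : Fin r => Pi.map fun _ : Fin n =>
        (Quotient.mk (permSetoid (D i) Disc) : (Fin (D i) → Disc) → SP (D i) Disc)) ⁻¹'
          {ξ : (i : Fin r) → Fin n → SP (D i) Disc | ∀ σ : Finset (Fin r), σ ∉ K →
            ¬ ∃ z : Disc, ∀ i ∈ σ, ∀ j : Fin n, z ∈ (ξ i j).toMultiset}) (fun x => by
        refine forall_congr' fun σ => imp_congr_right fun _ => not_congr (exists_congr fun z =>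
          forall_congr' fun i => imp_congr_right fun _ => forall_congr' fun j => ?_)
        exact mem_toMultiset_iff_mem_range.symm)
    exact h₂.comp e.isQuotientMap
  exact (isQuotientMap_quotient_mk' (s := confSetoid K n Disc discBoundary)).comp
    (isQuotientMap_sigmaMap h)

theorem Conf.points_injective {X : Type} {A : Set X} :
    Function.Injective (Conf.points : Conf K n X A → Fin r → Fin n → Multiset X) := by
  rintro ⟨a⟩ ⟨b⟩ h
  exact Quotient.sound h

theorem Conf.notMem_of_mem_points {X : Type} {A : Set X} (η : Conf K n X A) {i : Fin r} {j : Fin n}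
    {x : X} (h : x ∈ η.points i j) : x ∉ A := by
  induction η using Quotient.inductionOn with
  | h p => exact (mem_awayFrom.1 h).2

theorem Conf.noCommonPoint {X : Type} {A : Set X} (η : Conf K n X A) :
    NoCommonPoint K fun i j => {x | x ∈ η.points i j} := by
  induction η using Quotient.inductionOn with
  | h p => exact fun σ hσ ⟨x, hx⟩ => p.2.2 σ hσ ⟨x, fun i hi j => (mem_awayFrom.1 (hx i hi j)).1⟩

/-- A map to the configuration space is continuous at a point if it lifts to tuples near it. -/
theorem continuousAt_of_lift {Y : Type} [TopologicalSpace Y] {f : Y → DiscConf K n} {y : Y}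
    (D : Fin r → ℕ+) (g : Y → (i : Fin r) → Fin n → Fin (D i) → Disc) (hg : ContinuousAt g y)
    (hy : NoCommonPoint K fun i j => range (g y i j))
    (hf : ∀ y' i j, (f y').points i j =
      awayFrom discBoundary (Finset.univ.val.map (g y' i j))) : ContinuousAt f y := by
  classical
  let O := {x : (i : Fin r) → Fin n → Fin (D i) → Disc | NoCommonPoint K fun i j => range (x i j)}
  have hO : O ∈ 𝓝 (g y) := (isOpen_noCommonPoint D).mem_nhds hy
  -- The value `f y` off `O` is immaterial, because `g` takes values in `O` near `y`.
  let F : ((i : Fin r) → Fin n → Fin (D i) → Disc) → DiscConf K n :=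
    fun x => if h : x ∈ O then confOfTuple ⟨D, x, h⟩ else f y
  have hF : ContinuousOn F O := by
    rw [continuousOn_iff_continuous_domRestrict]
    have : O.domRestrict F = fun x => confOfTuple ⟨D, x⟩ :=
      funext fun x => dif_pos x.2
    rw [this]
    exact isQuotientMap_confOfTuple.continuous.comp
      (continuous_sigmaMk (σ := fun D : Fin r → ℕ+ => TupleConf K n D))
  refine ((hF.continuousAt hO).comp hg).congr ?_
  filter_upwards [hg.preimage_mem_nhds hO] with y' hy'
  refine Conf.points_injective ?_
  ext1 i
  ext1 j
  rw [hf, Function.comp_apply]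
  simp only [F]
  rw [dif_pos (show g y' ∈ O from hy'), points_confOfTuple]

/-! ### Padding by distinct boundary points -/

theorem infinite_discBoundary : discBoundary.Infinite := by
  have h : (Metric.sphere (0 : ℂ) 1).Infinite := by
    refine (isPreconnected_sphere ?_ (0 : ℂ) 1).infinite_of_nontrivial ⟨1, by simp, -1, by simp, ?_⟩
    · rw [Complex.rank_real_complex]
      exact Cardinal.one_lt_two
    · norm_num
  intro hfin
  refine h ((hfin.image Subtype.val).subset fun z hz => ⟨⟨z, Metric.sphere_subset_closedBall hz⟩, hz, rfl⟩)

theorem exists_boundary_family (V : Type) [Finite V] (Z : Set Disc) (hZ : Z.Finite) :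
    ∃ b : V → Disc, Function.Injective b ∧ ∀ v, b v ∈ discBoundary ∧ b v ∉ Z := by
  obtain ⟨N, ⟨e⟩⟩ := Finite.exists_equiv_fin V
  let c := (infinite_discBoundary.sdiff hZ).natEmbedding
  exact ⟨fun v => c (e v), fun v w h =>
    e.injective (Fin.val_injective (c.injective (Subtype.val_injective h))),
    fun v => (c (e v)).2⟩

/-- Padding by distinct new points creates no common points, provided that every non-face has at
least two elements. -/
theorem NoCommonPoint.pad (hK : ∀ σ ∉ K, σ.Nontrivial) {P Q : Fin r → Fin n → Set Disc}
    (hP : NoCommonPoint K P) {b : Fin r × Fin n → Disc} (hb : Function.Injective b)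
    (hbP : ∀ a i j, b a ∉ P i j) (hQ : ∀ i j, ∀ z ∈ Q i j, z ∈ P i j ∨ z = b (i, j)) :
    NoCommonPoint K Q := by
  rintro σ hσ ⟨z, hz⟩
  refine hP σ hσ ⟨z, fun i hi j => ?_⟩
  by_contra hzP
  -- The common point would be the padding point of `(i, j)`. At a second index `i'` of `σ` it would
  -- have to be an old point or the padding point of `(i', j)`, and it is neither.
  have hzb := (hQ i j z (hz i hi j)).resolve_left hzP
  obtain ⟨i', hi', hne⟩ := (hK σ hσ).exists_ne i
  rcases hQ i' j z (hz i' hi' j) with h | h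
  · exact hbP _ i' j (hzb ▸ h)
  · exact hne (congrArg Prod.fst (hb (h.symm.trans hzb)))

/-- Finite multisets of interior points without common points form a configuration. -/
theorem exists_conf (hK : ∀ σ ∉ K, σ.Nontrivial) (s : Fin r → Fin n → Multiset Disc)
    (hs : ∀ i j, ∀ z ∈ s i j, z ∉ discBoundary)
    (hP : NoCommonPoint K fun i j => {z | z ∈ s i j}) :
    ∃ η : DiscConf K n, ∀ i j, η.points i j = s i j := by
  classical
  obtain ⟨b, hb, hbA⟩ := exists_boundary_family (Fin r × Fin n) ∅ finite_empty
  let d := (Finset.univ.sup fun a : Fin r × Fin n => Multiset.card (s a.1 a.2)).succPNat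
  have hd : ∀ i j, Multiset.card (s i j) ≤ d := fun i j =>
    (Finset.le_sup (f := fun a : Fin r × Fin n => Multiset.card (s a.1 a.2))
      (Finset.mem_univ (i, j))).trans (Nat.le_succ _)
  choose x hx hxb using fun i j =>
    exists_padded_tuple d (s i j) (hd i j) (hs i j) (b (i, j)) (hbA _).1
  refine ⟨confOfTuple ⟨fun _ => d, x, ?_⟩, fun i j => (points_confOfTuple _ i j).trans (hx i j)⟩
  refine hP.pad hK hb (fun a i j h => hs i j _ h (hbA a).1) ?_
  rintro i j _ ⟨k, rfl⟩
  exact hxb i j k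

end Conf

/-! ### Radial expansion -/

/-- Radial expansion by the factor `l`, followed by radial projection onto the closed disc. -/
def clamp (l : ℝ) (z : Disc) : Disc := ⟨(max 1 ‖l • (z : ℂ)‖)⁻¹ • (l • (z : ℂ)), by
  rw [mem_closedBall_zero_iff, norm_smul, norm_inv, Real.norm_of_nonneg (by positivity),
    inv_mul_le_one₀ (by positivity)]
  exact le_max_right _ _⟩

theorem coe_clamp (l : ℝ) (z : Disc) :
    (clamp l z : ℂ) = (max 1 ‖l • (z : ℂ)‖)⁻¹ • (l • (z : ℂ)) := rfl

theorem clamp_of_le {l : ℝ} {z : Disc} (h : ‖l • (z : ℂ)‖ ≤ 1) : (clamp l z : ℂ) = l • (z : ℂ) := by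
  rw [coe_clamp, max_eq_left h, inv_one, one_smul]

theorem clamp_mem_discBoundary {l : ℝ} {z : Disc} :
    clamp l z ∈ discBoundary ↔ 1 ≤ ‖l • (z : ℂ)‖ := by
  rw [mem_discBoundary]
  constructor
  · intro h
    by_contra h'
    rw [clamp_of_le (not_le.1 h').le] at h
    exact h' h.ge
  · intro h
    rw [coe_clamp, max_eq_right h, norm_smul, norm_inv, norm_norm]
    exact inv_mul_cancel₀ (by positivity)

theorem clamp_mem_of_mem {l : ℝ} (hl : 1 ≤ l) {z : Disc} (hz : z ∈ discBoundary) :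
    clamp l z ∈ discBoundary := by
  rw [clamp_mem_discBoundary, norm_smul, mem_discBoundary.1 hz, mul_one, Real.norm_eq_abs]
  exact hl.trans (le_abs_self l)

theorem clamp_one (z : Disc) : clamp 1 z = z := by
  ext
  rw [clamp_of_le (by simpa using z.norm_le), one_smul]

theorem continuous_clamp : Continuous fun p : ℝ × Disc => clamp p.1 p.2 := by
  refine Continuous.subtype_mk ?_ _
  have h : ∀ p : ℝ × Disc, max 1 ‖p.1 • (p.2 : ℂ)‖ ≠ 0 := fun p => by positivity
  exact ((by fun_prop : Continuous fun p : ℝ × Disc => max 1 ‖p.1 • (p.2 : ℂ)‖).inv₀ h).smul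
    (by fun_prop)

/-- Radial expansion by the factor `l` of a configuration in the disc. -/
def expandDisc (l : ℝ) (s : Multiset Disc) : Multiset Disc :=
  awayFrom discBoundary (s.map (clamp l))

theorem map_val_expandDisc (l : ℝ) (s : Multiset Disc) :
    (expandDisc l s).map (Subtype.val : Disc → ℂ) = radialExpand l s := by
  rw [expandDisc, radialExpand,
    awayFrom_map (A := {z : Disc | 1 ≤ ‖l • (z : ℂ)‖}) (clamp l) fun z => clamp_mem_discBoundary,
    awayFrom_map (A := {z : Disc | 1 ≤ ‖l • (z : ℂ)‖}) (fun z : Disc => l • (z : ℂ)) fun z => Iff.rfl,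
    Multiset.map_map]
  exact Multiset.map_congr rfl fun z hz => clamp_of_le (not_le.1 (mem_awayFrom.1 hz).2).le

theorem awayFrom_map_congr {X Y : Type} {A : Set Y} {f g : X → Y} (s : Multiset X)
    (h : ∀ x ∈ s, f x = g x ∨ f x ∈ A ∧ g x ∈ A) :
    awayFrom A (s.map f) = awayFrom A (s.map g) := by
  induction s using Multiset.induction_on with
  | empty => rfl
  | cons x s ih =>
    have ih' := ih fun y hy => h y (Multiset.mem_cons_of_mem hy)
    rw [Multiset.map_cons, Multiset.map_cons]
    rcases h x (Multiset.mem_cons_self x s) with hx | ⟨hf, hg⟩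
    · by_cases hg : g x ∈ A
      · rw [awayFrom_cons_of_mem _ hg, hx, awayFrom_cons_of_mem _ hg, ih']
      · rw [awayFrom_cons_of_notMem _ hg, hx, awayFrom_cons_of_notMem _ hg, ih']
    · rw [awayFrom_cons_of_mem _ hf, awayFrom_cons_of_mem _ hg, ih']

/-- For `l ≥ 1` boundary points stay on the boundary, so expansion depends only on the points in the
open disc. -/
theorem expandDisc_awayFrom {l : ℝ} (hl : 1 ≤ l) (s : Multiset Disc) :
    expandDisc l (awayFrom discBoundary s) = expandDisc l s := by
  induction s using Multiset.induction_on with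
  | empty => simp [awayFrom]
  | cons x s ih =>
    by_cases hx : x ∈ discBoundary
    · rw [awayFrom_cons_of_mem _ hx, ih, expandDisc, expandDisc, Multiset.map_cons,
        awayFrom_cons_of_mem _ (clamp_mem_of_mem hl hx)]
    · rw [awayFrom_cons_of_notMem _ hx]
      rw [expandDisc, expandDisc] at ih ⊢
      rw [Multiset.map_cons, Multiset.map_cons]
      by_cases hc : clamp l x ∈ discBoundary
      · rw [awayFrom_cons_of_mem _ hc, awayFrom_cons_of_mem _ hc, ih]
      · rw [awayFrom_cons_of_notMem _ hc, awayFrom_cons_of_notMem _ hc, ih]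

theorem expandDisc_one {s : Multiset Disc} (hs : ∀ z ∈ s, z ∉ discBoundary) :
    expandDisc 1 s = s := by
  rw [expandDisc, Multiset.map_congr rfl fun z _ => clamp_one z, Multiset.map_id',
    awayFrom_eq_self hs]

theorem mem_expandDisc {l : ℝ} {s : Multiset Disc} {u : Disc} (h : u ∈ expandDisc l s) :
    u ∉ discBoundary ∧ ∃ z ∈ s, (u : ℂ) = l • (z : ℂ) := by
  obtain ⟨hu, hu'⟩ := mem_awayFrom.1 h
  obtain ⟨z, hz, rfl⟩ := Multiset.mem_map.1 hu
  refine ⟨hu', z, hz, clamp_of_le ?_⟩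
  rw [clamp_mem_discBoundary, not_le] at hu'
  exact hu'.le

section Conf

variable {r n : ℕ} {K : Set (Finset (Fin r))}

/-- Division by `l ≥ 1` stays in the disc and turns a common point of the expanded sets into one of
the original sets. -/
theorem NoCommonPoint.expand {P : Fin r → Fin n → Set Disc} (hP : NoCommonPoint K P) {l : ℝ}
    (hl : 1 ≤ l) : NoCommonPoint K fun i j => {u : Disc | ∃ z ∈ P i j, (u : ℂ) = l • (z : ℂ)} := by
  rintro σ hσ ⟨u, hu⟩
  refine hP σ hσ ⟨⟨l⁻¹ • (u : ℂ), ?_⟩, fun i hi j => ?_⟩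
  · rw [mem_closedBall_zero_iff, norm_smul, norm_inv, Real.norm_of_nonneg (by positivity)]
    exact mul_le_one₀ (inv_le_one_of_one_le₀ hl) (norm_nonneg _) u.norm_le
  · obtain ⟨z, hz, h⟩ := hu i hi j
    convert hz
    rw [h, inv_smul_smul₀ (by positivity)]

theorem exists_expandConf (hK : ∀ σ ∉ K, σ.Nontrivial) {l : ℝ} (hl : 1 ≤ l) (η : DiscConf K n) :
    ∃ η' : DiscConf K n, ∀ i j, η'.points i j = expandDisc l (η.points i j) :=
  exists_conf hK _ (fun _ _ _ hz => (mem_expandDisc hz).1)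
    ((η.noCommonPoint.expand hl).mono fun _ _ _ hu => (mem_expandDisc hu).2)

theorem exists_gap {T : Set ℝ} (hT : T.Finite) : ∃ c : ℝ, 1 < c ∧ ∀ t ∈ T, t ≤ 1 ∨ c < t := by
  have h : ∀ᶠ c in 𝓝[>] (1 : ℝ), ∀ t ∈ T, t ≤ 1 ∨ c < t := by
    refine (Filter.eventually_all_finite hT).2 fun t _ => ?_
    rcases le_or_gt t 1 with ht | ht
    · exact Filter.Eventually.of_forall fun _ => Or.inl ht
    · filter_upwards [mem_nhdsWithin_of_mem_nhds (Iio_mem_nhds ht)] with c hc using Or.inr hc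
  exact (Filter.Eventually.and (self_mem_nhdsWithin : ∀ᶠ c in 𝓝[>] (1 : ℝ), 1 < c) h).exists

/-- Radial expansion by a continuous factor is continuous. -/
theorem continuous_expand (hK : ∀ σ ∉ K, σ.Nontrivial) {Y : Type} [TopologicalSpace Y]
    {D : Fin r → ℕ+} {l : Y → ℝ} (hl : Continuous l) (hl₁ : ∀ y, 1 ≤ l y)
    {x : Y → TupleConf K n D} (hx : Continuous x) {f : Y → DiscConf K n}
    (hf : ∀ y i j, (f y).points i j = expandDisc (l y) ((confOfTuple ⟨D, x y⟩).points i j)) :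
    Continuous f := by
  classical
  refine continuous_iff_continuousAt.2 fun y₀ => ?_
  let ν : Y → (i : Fin r) → Fin n → Fin (D i) → ℝ := fun y i j k =>
    ‖l y • ((x y).1 i j k : ℂ)‖
  have hxc : ∀ i j k, Continuous fun y => (x y).1 i j k := fun i j k =>
    (continuous_apply k).comp ((continuous_apply j).comp ((continuous_apply i).comp
      (continuous_subtype_val.comp hx)))
  have hν : ∀ i j k, Continuous fun y => ν y i j k := fun i j k =>
    (hl.smul (continuous_subtype_val.comp (hxc i j k))).norm
  -- At `y₀` no expanded norm lies in `(1, c]`, so comparison with `c` splits the points in the same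
  -- way for all `y` near `y₀`.
  obtain ⟨c, hc, hcν⟩ := exists_gap (finite_range fun a : (i : Fin r) × Fin n × Fin (D i) =>
    ν y₀ a.1 a.2.1 a.2.2)
  obtain ⟨b, hb, hbZ⟩ := exists_boundary_family (Fin r × Fin n) _
    (finite_range fun a : (i : Fin r) × Fin n × Fin (D i) =>
      clamp (l y₀) ((x y₀).1 a.1 a.2.1 a.2.2))
  have hgap : ∀ i j k, ν y₀ i j k ≤ 1 ∨ c < ν y₀ i j k := fun i j k =>
    hcν _ ⟨⟨i, j, k⟩, rfl⟩
  -- Clamping alone could send points of different configurations to the same boundary point and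
  -- create a forbidden common point. Points beyond `c` are therefore replaced by padding points,
  -- which differ from all clamped points at `y₀`. Points near norm 1 stay clamped, which keeps the
  -- lift continuous.
  refine continuousAt_of_lift D (fun y i j k => if ν y i j k < c then
    clamp (l y) ((x y).1 i j k) else b (i, j)) ?_ ?_ ?_
  · refine continuousAt_pi.2 fun i => continuousAt_pi.2 fun j => continuousAt_pi.2 fun k => ?_
    rcases hgap i j k with h | h
    · refine (continuous_clamp.comp (hl.prodMk (hxc i j k))).continuousAt.congr ?_
      filter_upwards [(hν i j k).continuousAt.eventually_lt_const (h.trans_lt hc)] with y hy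
      exact (if_pos hy).symm
    · refine (continuousAt_const (y := b (i, j))).congr ?_
      filter_upwards [(hν i j k).continuousAt.eventually_const_lt h] with y hy
      exact (if_neg hy.not_gt).symm
  · refine NoCommonPoint.pad (P := fun i j => {u | ∃ k, ν y₀ i j k ≤ 1 ∧
      u = clamp (l y₀) ((x y₀).1 i j k)}) hK ?_ hb ?_ ?_
    · refine ((x y₀).2.expand (hl₁ y₀)).mono ?_
      rintro i j _ ⟨k, hk, rfl⟩
      exact ⟨_, mem_range_self k, clamp_of_le hk⟩
    · rintro a i j ⟨k, -, h⟩
      exact (hbZ a).2 ⟨⟨i, j, k⟩, h.symm⟩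
    · rintro i j _ ⟨k, rfl⟩
      rcases hgap i j k with h | h
      · exact Or.inl ⟨k, h, if_pos (h.trans_lt hc)⟩
      · exact Or.inr (if_neg h.not_gt)
  · intro y i j
    rw [hf, points_confOfTuple, expandDisc_awayFrom (hl₁ y), expandDisc, Multiset.map_map]
    refine awayFrom_map_congr _ fun k _ => ?_
    by_cases h : ν y i j k < c
    · exact Or.inl (if_pos h).symm
    · refine Or.inr ⟨clamp_mem_discBoundary.2 (hc.le.trans (not_lt.1 h)), ?_⟩
      rw [if_neg h]
      exact (hbZ _).1

/-! ### The margin of a configuration -/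

/-- The norm of a point of the disc, as an element of the unit interval. -/
def discNorm (z : Disc) : unitInterval := ⟨‖(z : ℂ)‖, norm_nonneg _, z.norm_le⟩

theorem continuous_discNorm : Continuous discNorm :=
  Continuous.subtype_mk (by fun_prop) _

/-- The distance from the origin to a configuration in the disc; `1` if there are no points. -/
def innerRadius (s : Multiset Disc) : unitInterval := (s.map discNorm).inf

theorem le_innerRadius {s : Multiset Disc} {a : unitInterval} :
    a ≤ innerRadius s ↔ ∀ z ∈ s, a ≤ discNorm z := by
  rw [innerRadius, Multiset.le_inf, Multiset.forall_mem_map_iff]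

theorem innerRadius_pos {s : Multiset Disc} (h : ∀ z ∈ s, (z : ℂ) ≠ 0) : 0 < innerRadius s := by
  induction s using Multiset.induction_on with
  | empty => exact zero_lt_one
  | cons z s ih =>
    rw [innerRadius, Multiset.map_cons, Multiset.inf_cons]
    exact lt_inf_iff.2 ⟨norm_pos_iff.2 (h z (Multiset.mem_cons_self z s)),
      ih fun w hw => h w (Multiset.mem_cons_of_mem hw)⟩

/-- Boundary points have norm 1, the top of the interval, and do not affect the infimum. Hence the
radius can be computed, and its continuity tested, on tuples. -/
theorem innerRadius_awayFrom (s : Multiset Disc) :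
    innerRadius (awayFrom discBoundary s) = innerRadius s := by
  refine eq_of_forall_le_iff fun a => ?_
  simp only [le_innerRadius, mem_awayFrom]
  refine forall_congr' fun z => ⟨fun h hz => ?_, fun h hz => h hz.1⟩
  by_cases hz' : z ∈ discBoundary
  · have : discNorm z = 1 := Subtype.ext (mem_discBoundary.1 hz')
    exact this ▸ unitInterval.le_one'
  · exact h ⟨hz, hz'⟩

theorem innerRadius_tuple {d : ℕ} (x : Fin d → Disc) :
    innerRadius (Finset.univ.val.map x) = Finset.univ.inf fun k => discNorm (x k) := by
  refine eq_of_forall_le_iff fun a => ?_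
  simp [le_innerRadius]

open Classical in
/-- The largest radius such that, for every non-face `σ`, some configuration with index in
`σ × [n]` has no points of smaller norm; at most `1`. -/
def margin (η : DiscConf K n) : unitInterval :=
  (Finset.univ.filter (· ∉ K)).inf fun σ =>
    (σ ×ˢ (Finset.univ : Finset (Fin n))).sup fun a => innerRadius (η.points a.1 a.2)

theorem continuous_innerRadius_points (i : Fin r) (j : Fin n) :
    Continuous fun η : DiscConf K n => innerRadius (η.points i j) := by
  refine isQuotientMap_confOfTuple.continuous_iff.2 (continuous_sigma fun D => ?_)
  have h : Continuous fun x : TupleConf K n D => Finset.univ.inf fun k => discNorm (x.1 i j k) := by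
    refine Continuous.finset_inf_apply fun k _ => continuous_discNorm.comp ?_
    exact (continuous_apply k).comp ((continuous_apply j).comp ((continuous_apply i).comp
      continuous_subtype_val))
  refine h.congr fun x => ?_
  rw [← innerRadius_tuple, Function.comp_apply, points_confOfTuple, innerRadius_awayFrom]

theorem continuous_margin : Continuous (margin : DiscConf K n → unitInterval) := by
  unfold margin
  exact Continuous.finset_inf_apply fun σ _ => Continuous.finset_sup_apply fun a _ =>
    continuous_innerRadius_points a.1 a.2

/-- The origin is not a common point for any of the finitely many non-faces, so each has an index
whose configuration misses it. -/
theorem margin_pos (η : DiscConf K n) : 0 < margin η := by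
  refine (Finset.lt_inf_iff (by exact zero_lt_one)).2 fun σ hσ => ?_
  have hσ' : σ ∉ K := by simpa using hσ
  have h := η.noCommonPoint σ hσ'
  push Not at h
  obtain ⟨i, hi, j, hij⟩ := h ⟨0, by simp⟩
  refine Finset.lt_sup_iff.2 ⟨(i, j), by simpa using hi, innerRadius_pos fun z hz h0 => hij ?_⟩
  have : z = ⟨0, by simp⟩ := Subtype.ext h0
  exact this ▸ hz

theorem exists_margin_le {η : DiscConf K n} {σ : Finset (Fin r)} (hσ : σ ∉ K) :
    ∃ i ∈ σ, ∃ j, margin η ≤ innerRadius (η.points i j) := by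
  classical
  have h : margin η ≤ (σ ×ˢ (Finset.univ : Finset (Fin n))).sup fun a =>
      innerRadius (η.points a.1 a.2) := Finset.inf_le (by simpa using hσ)
  -- A bound below a finite supremum is attained by some index only if it exceeds the empty supremum
  -- 0; positivity of the margin provides this.
  obtain ⟨a, ha, h'⟩ := (Finset.le_sup_iff (margin_pos η)).1 h
  exact ⟨a.1, (Finset.mem_product.1 ha).1, a.2, h'⟩

theorem margin_eq_one {η : DiscConf K n}
    (h : ∀ σ ∉ K, ∃ i ∈ σ, ∃ j, η.points i j = 0) : margin η = 1 := by
  refine le_antisymm unitInterval.le_one' (Finset.le_inf fun σ hσ => ?_)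
  obtain ⟨i, hi, j, hij⟩ := h σ (by simpa using hσ)
  refine le_trans ?_ (Finset.le_sup (f := fun a => innerRadius (η.points a.1 a.2)) (b := (i, j))
    (by simpa using hi))
  rw [le_innerRadius, hij]
  simp

/-- The factor of the radial expansion at time `t`. -/
def expansionFactor (p : unitInterval × DiscConf K n) : ℝ :=
  1 + (p.1 : ℝ) * ((margin p.2 : ℝ)⁻¹ - 1)

theorem continuous_expansionFactor :
    Continuous (expansionFactor : unitInterval × DiscConf K n → ℝ) := by
  have h : Continuous fun p : unitInterval × DiscConf K n => (margin p.2 : ℝ) :=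
    continuous_subtype_val.comp (continuous_margin.comp continuous_snd)
  have h' := h.inv₀ fun p => (unitInterval.coe_pos.2 (margin_pos p.2)).ne'
  exact continuous_const.add ((continuous_subtype_val.comp continuous_fst).mul
    (h'.sub continuous_const))

theorem one_le_expansionFactor (p : unitInterval × DiscConf K n) : 1 ≤ expansionFactor p := by
  have h : 1 ≤ (margin p.2 : ℝ)⁻¹ :=
    (one_le_inv₀ (unitInterval.coe_pos.2 (margin_pos p.2))).2 unitInterval.le_one'
  exact le_add_of_nonneg_right (mul_nonneg p.1.2.1 (sub_nonneg.2 h))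

theorem expansionFactor_zero (η : DiscConf K n) : expansionFactor (0, η) = 1 := by
  simp [expansionFactor]

theorem expansionFactor_of_margin (t : unitInterval) {η : DiscConf K n} (h : margin η = 1) :
    expansionFactor (t, η) = 1 := by
  simp [expansionFactor, h]

/-- After the full expansion, some configuration is empty for every non-face. -/
theorem exists_expandDisc_eq_zero (η : DiscConf K n) {σ : Finset (Fin r)} (hσ : σ ∉ K) :
    ∃ i ∈ σ, ∃ j, expandDisc (expansionFactor (1, η)) (η.points i j) = 0 := by
  obtain ⟨i, hi, j, hij⟩ := exists_margin_le (η := η) hσ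
  refine ⟨i, hi, j, awayFrom_eq_zero fun u hu => ?_⟩
  obtain ⟨z, hz, rfl⟩ := Multiset.mem_map.1 hu
  have hm : 0 < (margin η : ℝ) := unitInterval.coe_pos.2 (margin_pos η)
  have hz' : (margin η : ℝ) ≤ ‖(z : ℂ)‖ := le_innerRadius.1 hij z hz
  have hl : expansionFactor (1, η) = (margin η : ℝ)⁻¹ := by simp [expansionFactor]
  rw [clamp_mem_discBoundary, norm_smul, hl, norm_inv, Real.norm_of_nonneg hm.le,
    one_le_inv_mul₀ hm]
  exact hz'

/-! ### The deformation by radial expansion -/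

/-- The deformation of the configuration space by radial expansion. -/
def expandMap (hK : ∀ σ ∉ K, σ.Nontrivial) (p : unitInterval × DiscConf K n) : DiscConf K n :=
  (exists_expandConf hK (one_le_expansionFactor p) p.2).choose

theorem points_expandMap (hK : ∀ σ ∉ K, σ.Nontrivial) (p : unitInterval × DiscConf K n) (i : Fin r)
    (j : Fin n) : (expandMap hK p).points i j = expandDisc (expansionFactor p) (p.2.points i j) :=
  (exists_expandConf hK (one_le_expansionFactor p) p.2).choose_spec i j

/-- The product of a quotient map with the locally compact unit interval is again a quotient map, so
it suffices to treat tuples of one fixed degree. -/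
theorem continuous_expandMap (hK : ∀ σ ∉ K, σ.Nontrivial) :
    Continuous (expandMap hK : unitInterval × DiscConf K n → DiscConf K n) := by
  refine isQuotientMap_confOfTuple.continuous_lift_prod_right ?_
  rw [← ((Homeomorph.prodComm _ _).trans Homeomorph.sigmaProdDistrib).symm.comp_continuous_iff']
  refine continuous_sigma fun D => ?_
  refine continuous_expand hK (Y := TupleConf K n D × unitInterval) (D := D)
    (l := fun y => expansionFactor (y.2, confOfTuple ⟨D, y.1⟩)) ?_
    (fun y => one_le_expansionFactor _) (x := Prod.fst) continuous_fst
    (fun y i j => points_expandMap hK _ i j)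
  exact continuous_expansionFactor.comp (continuous_snd.prodMk
    (isQuotientMap_confOfTuple.continuous.comp ((continuous_sigmaMk
      (σ := fun D : Fin r → ℕ+ => TupleConf K n D)).comp continuous_fst)))

theorem expandMap_of_factor (hK : ∀ σ ∉ K, σ.Nontrivial) {p : unitInterval × DiscConf K n}
    (h : expansionFactor p = 1) : expandMap hK p = p.2 := by
  refine Conf.points_injective (funext fun i => funext fun j => ?_)
  rw [points_expandMap, h, expandDisc_one fun z hz => p.2.notMem_of_mem_points hz]

end Conf

/-! ### The forgetful map to the infinite symmetric products -/

section Conf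

variable {r n : ℕ} {K : Set (Finset (Fin r))}

theorem exists_toSphere (η : DiscConf K n) (a : Fin r × Fin n) :
    ∃ w : SPSphere, w.points = (η.points a.1 a.2).map collapse :=
  exists_sphere_of_points _ fun _ hz => η.notMem_of_mem_points hz

/-- The configuration with index `a`, in the sphere. -/
def toSphere (η : DiscConf K n) (a : Fin r × Fin n) : SPSphere := (exists_toSphere η a).choose

theorem points_toSphere (η : DiscConf K n) (a : Fin r × Fin n) :
    (toSphere η a).points = (η.points a.1 a.2).map collapse := (exists_toSphere η a).choose_spec

theorem continuous_toSphere : Continuous (toSphere : DiscConf K n → Fin r × Fin n → SPSphere) := by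
  refine continuous_pi fun a => isQuotientMap_confOfTuple.continuous_iff.2
    (continuous_sigma fun D => ?_)
  have h : Continuous fun x : TupleConf K n D => sphereOfTuple ⟨D a.1, x.1 a.1 a.2⟩ :=
    isQuotientMap_sphereOfTuple.continuous.comp ((continuous_sigmaMk
      (σ := fun d : ℕ+ => Fin d → Disc)).comp ((continuous_apply a.2).comp
        ((continuous_apply a.1).comp continuous_subtype_val)))
  refine h.congr fun x => SPInf.points_injective ?_
  rw [points_sphereOfTuple, Function.comp_apply, points_toSphere, points_confOfTuple]

/-! ### The inclusion of the polyhedral product -/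

theorem exists_discPoints (w : SPSphere) :
    ∃ s : Multiset Disc, (∀ z ∈ s, z ∉ discBoundary) ∧ s.map collapse = w.points := by
  obtain ⟨p, rfl⟩ := isQuotientMap_sphereOfTuple.surjective w
  exact ⟨_, fun z hz => (mem_awayFrom.1 hz).2, (points_sphereOfTuple p).symm⟩

/-- The points of the open disc that correspond to a configuration in the sphere. -/
def discPoints (w : SPSphere) : Multiset Disc := (exists_discPoints w).choose

theorem notMem_of_mem_discPoints {w : SPSphere} {z : Disc} (h : z ∈ discPoints w) :
    z ∉ discBoundary := (exists_discPoints w).choose_spec.1 z h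

theorem map_collapse_discPoints (w : SPSphere) : (discPoints w).map collapse = w.points :=
  (exists_discPoints w).choose_spec.2

theorem discPoints_eq {w : SPSphere} {s : Multiset Disc} (hs : ∀ z ∈ s, z ∉ discBoundary)
    (h : w.points = s.map collapse) : discPoints w = s :=
  map_collapse_injOn (fun _ => notMem_of_mem_discPoints) hs ((map_collapse_discPoints w).trans h)

theorem discPoints_sphereOfTuple (p : (d : ℕ+) × (Fin d → Disc)) :
    discPoints (sphereOfTuple p) = awayFrom discBoundary (Finset.univ.val.map p.2) :=
  discPoints_eq (fun _ hz => (mem_awayFrom.1 hz).2) (points_sphereOfTuple p)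

theorem discPoints_eq_zero {w : SPSphere} (h : w.points = 0) : discPoints w = 0 :=
  discPoints_eq (fun _ hz => absurd hz (Multiset.notMem_zero _)) (by rw [h, Multiset.map_zero])

/-- The continuity of maps from finite powers of the infinite symmetric product of the sphere can be
checked on tuples. -/
theorem continuous_of_sphereOfTuple {E V : Type} [TopologicalSpace E] [Finite V]
    (f : (V → SPSphere) → E)
    (hf : ∀ d : ℕ, Continuous fun p : V → Fin d.succPNat → Disc =>
      f fun v => sphereOfTuple ⟨d.succPNat, p v⟩) : Continuous f := by
  refine continuous_of_forall_box
    (fun (d : ℕ) (x : Fin d.succPNat → Disc) => sphereOfTuple ⟨d.succPNat, x⟩)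
    (fun d => isQuotientMap_sphereOfTuple.continuous.comp
      (continuous_sigmaMk (σ := fun d : ℕ+ => Fin d → Disc))) ?_ ?_ ?_ f hf
  · rintro d e hde _ ⟨x, rfl⟩
    refine exists_sphere_of_tuple_le _ e.succPNat ?_
    rw [points_sphereOfTuple, Multiset.card_map]
    refine (card_awayFrom_le _ _).trans ?_
    rw [Multiset.card_map]
    exact (Finset.card_fin _).le.trans (Nat.succ_le_succ hde)
  · refine eq_univ_of_forall fun w => mem_iUnion.2 ⟨Multiset.card w.points, ?_⟩
    exact exists_sphere_of_tuple_le w _ (Nat.le_succ _)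
  · intro A hA
    refine isQuotientMap_sphereOfTuple.isClosed_preimage.1 (isClosed_sigma_iff.2 fun d => ?_)
    obtain ⟨d, rfl⟩ : ∃ e : ℕ, e.succPNat = d := ⟨d.natPred, d.succPNat_natPred⟩
    exact hA d

open Classical in
/-- The points of a family of configurations in the sphere, with those outside `τ` dropped. -/
def facePoints (τ : Finset (Fin r × Fin n)) (w : Fin r × Fin n → SPSphere) (i : Fin r)
    (j : Fin n) : Multiset Disc :=
  if (i, j) ∈ τ then discPoints (w (i, j)) else 0

/-- For a non-face `σ` the set `σ × [n]` is not contained in `τ`, so one of its indices contributes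
the empty set. -/
theorem noCommonPoint_of_face {τ : Finset (Fin r × Fin n)} (hτ : τ ∈ thickComplex K n)
    {X : Type} (P : Fin r → Fin n → Set X) :
    NoCommonPoint K fun i j => {z | (i, j) ∈ τ ∧ z ∈ P i j} := by
  rintro σ hσ ⟨z, hz⟩
  refine hτ σ hσ fun a ha => (hz a.1 (Finset.mem_product.1 ha).1 a.2).1

theorem exists_faceConf (hK : ∀ σ ∉ K, σ.Nontrivial) {τ : Finset (Fin r × Fin n)}
    (hτ : τ ∈ thickComplex K n) (w : Fin r × Fin n → SPSphere) :
    ∃ η : DiscConf K n, ∀ i j, η.points i j = facePoints τ w i j := by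
  refine exists_conf hK _ (fun i j z hz => ?_)
    ((noCommonPoint_of_face hτ fun _ _ => univ).mono fun i j z hz => ⟨?_, mem_univ z⟩)
  · rw [facePoints] at hz
    split_ifs at hz
    · exact notMem_of_mem_discPoints hz
    · exact absurd hz (Multiset.notMem_zero z)
  · rw [mem_ofPred_eq, facePoints] at hz
    by_contra h
    rw [if_neg h] at hz
    exact absurd hz (Multiset.notMem_zero z)

/-- The configuration in the disc given by a family of configurations in the sphere, with those
outside a face `τ` dropped. -/
def faceConf (hK : ∀ σ ∉ K, σ.Nontrivial) {τ : Finset (Fin r × Fin n)}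
    (hτ : τ ∈ thickComplex K n) (w : Fin r × Fin n → SPSphere) : DiscConf K n :=
  (exists_faceConf hK hτ w).choose

theorem points_faceConf (hK : ∀ σ ∉ K, σ.Nontrivial) {τ : Finset (Fin r × Fin n)}
    (hτ : τ ∈ thickComplex K n) (w : Fin r × Fin n → SPSphere) (i : Fin r) (j : Fin n) :
    (faceConf hK hτ w).points i j = facePoints τ w i j :=
  (exists_faceConf hK hτ w).choose_spec i j

/-- Dropping the coordinates outside a fixed face extends the inclusion to the whole power of
`SP^∞`, where continuity can be tested on tuples. Coordinates in the face may coincide freely; the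
dropped slots hold padding points. -/
theorem continuous_faceConf (hK : ∀ σ ∉ K, σ.Nontrivial) {τ : Finset (Fin r × Fin n)}
    (hτ : τ ∈ thickComplex K n) : Continuous (faceConf hK hτ) := by
  classical
  refine continuous_of_sphereOfTuple _ fun d => continuous_iff_continuousAt.2 fun p₀ => ?_
  obtain ⟨b, hb, hbZ⟩ := exists_boundary_family (Fin r × Fin n) _
    (finite_range fun a : (Fin r × Fin n) × Fin d.succPNat => p₀ a.1 a.2)
  refine continuousAt_of_lift (fun _ => d.succPNat)
    (fun p i j => if (i, j) ∈ τ then p (i, j) else fun _ => b (i, j)) ?_ ?_ ?_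
  · refine Continuous.continuousAt (continuous_pi fun i => continuous_pi fun j => ?_)
    split_ifs <;> fun_prop
  · refine (noCommonPoint_of_face hτ fun i j => range (p₀ (i, j))).pad hK hb ?_ ?_
    · rintro a i j ⟨-, k, hk⟩
      exact (hbZ a).2 ⟨⟨(i, j), k⟩, hk⟩
    · rintro i j _ ⟨k, rfl⟩
      by_cases h : (i, j) ∈ τ
      · rw [if_pos h]
        exact Or.inl ⟨h, mem_range_self k⟩
      · rw [if_neg h]
        exact Or.inr rfl
  · intro p i j
    rw [points_faceConf, facePoints]
    split_ifs with h
    · exact discPoints_sphereOfTuple _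
    · refine (awayFrom_eq_zero fun z hz => ?_).symm
      obtain ⟨_, -, rfl⟩ := Multiset.mem_map.1 hz
      exact (hbZ _).1

/-- The polyhedral product of the infinite symmetric product of the sphere. -/
abbrev SpherePolyProd (K : Set (Finset (Fin r))) (n : ℕ) : Type :=
  ↥(polyProd (thickComplex K n) SPSphere {w | w.points = 0})

theorem facePoints_eq {τ : Finset (Fin r × Fin n)} {w : Fin r × Fin n → SPSphere}
    (h : ∀ a ∉ τ, (w a).points = 0) (i : Fin r) (j : Fin n) :
    facePoints τ w i j = discPoints (w (i, j)) := by
  rw [facePoints]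
  split_ifs with h'
  · rfl
  · exact (discPoints_eq_zero (h _ h')).symm

theorem exists_inclConf (hK : ∀ σ ∉ K, σ.Nontrivial) (w : SpherePolyProd K n) :
    ∃ η : DiscConf K n, ∀ i j, η.points i j = discPoints (w.1 (i, j)) := by
  obtain ⟨τ, hτ, h⟩ := w.2
  exact ⟨faceConf hK hτ w.1, fun i j => by rw [points_faceConf, facePoints_eq h]⟩

/-- The inclusion of the polyhedral product into the configuration space. -/
def inclConf (hK : ∀ σ ∉ K, σ.Nontrivial) (w : SpherePolyProd K n) : DiscConf K n :=
  (exists_inclConf hK w).choose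

theorem points_inclConf (hK : ∀ σ ∉ K, σ.Nontrivial) (w : SpherePolyProd K n) (i : Fin r)
    (j : Fin n) : (inclConf hK w).points i j = discPoints (w.1 (i, j)) :=
  (exists_inclConf hK w).choose_spec i j

/-- The faces give a finite cover by sets that are closed because `SP^∞(S², ∞)` is Hausdorff, and on
each of them the inclusion agrees with a `faceConf`. -/
theorem continuous_inclConf (hK : ∀ σ ∉ K, σ.Nontrivial) :
    Continuous (inclConf hK : SpherePolyProd K n → DiscConf K n) := by
  let Z : {τ // τ ∈ thickComplex K n} → Set (SpherePolyProd K n) := fun τ =>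
    {w | ∀ a ∉ τ.1, (w.1 a).points = 0}
  have hZ : LocallyFinite Z := locallyFinite_of_finite Z
  refine hZ.continuous ?_ (fun τ => ?_) fun τ => ?_
  · refine eq_univ_of_forall fun w => ?_
    obtain ⟨τ, hτ, h⟩ := w.2
    exact mem_iUnion.2 ⟨⟨τ, hτ⟩, h⟩
  · have : Z τ = ⋂ a ∈ {a | a ∉ τ.1}, (fun w : SpherePolyProd K n => w.1 a) ⁻¹' {emptySphere} := by
      ext w
      simp [Z, points_eq_zero_iff]
    rw [this]
    refine isClosed_biInter fun a _ => isClosed_singleton.preimage ?_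
    exact (continuous_apply a).comp continuous_subtype_val
  · refine ((continuous_faceConf hK τ.2).comp continuous_subtype_val).continuousOn.congr fun w hw => ?_
    refine Conf.points_injective (funext fun i => funext fun j => ?_)
    rw [points_inclConf, Function.comp_apply, points_faceConf, facePoints_eq hw]

theorem margin_inclConf (hK : ∀ σ ∉ K, σ.Nontrivial) (w : SpherePolyProd K n) :
    margin (inclConf hK w) = 1 := by
  refine margin_eq_one fun σ hσ => ?_
  obtain ⟨τ, hτ, h⟩ := w.2
  obtain ⟨a, ha, haτ⟩ := Finset.not_subset.1 (hτ σ hσ)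
  refine ⟨a.1, (Finset.mem_product.1 ha).1, a.2, ?_⟩
  rw [points_inclConf]
  exact discPoints_eq_zero (h a haτ)

/-! ### The retraction and the homotopy equivalence -/

/-- The witnessing face is the set of indices with nonempty configurations: the full expansion
empties one configuration for every non-face. -/
theorem toSphere_expandMap_mem (hK : ∀ σ ∉ K, σ.Nontrivial) (η : DiscConf K n) :
    toSphere (expandMap hK (1, η)) ∈ polyProd (thickComplex K n) SPSphere {w | w.points = 0} := by
  classical
  refine ⟨Finset.univ.filter fun a => (expandMap hK (1, η)).points a.1 a.2 ≠ 0,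
    fun σ hσ h => ?_, fun a ha => ?_⟩
  · obtain ⟨i, hi, j, hij⟩ := exists_expandDisc_eq_zero η hσ
    have := h (show (i, j) ∈ _ from Finset.mem_product.2 ⟨hi, Finset.mem_univ j⟩)
    rw [Finset.mem_filter, points_expandMap] at this
    exact this.2 hij
  · have : (expandMap hK (1, η)).points a.1 a.2 = 0 := by simpa using ha
    rw [mem_ofPred_eq, points_toSphere, this, Multiset.map_zero]

/-- The retraction onto the polyhedral product. -/
def retConf (hK : ∀ σ ∉ K, σ.Nontrivial) (η : DiscConf K n) : SpherePolyProd K n :=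
  ⟨toSphere (expandMap hK (1, η)), toSphere_expandMap_mem hK η⟩

theorem continuous_retConf (hK : ∀ σ ∉ K, σ.Nontrivial) :
    Continuous (retConf hK : DiscConf K n → SpherePolyProd K n) :=
  (continuous_toSphere.comp ((continuous_expandMap hK).comp (by fun_prop))).subtype_mk _

theorem inclConf_retConf (hK : ∀ σ ∉ K, σ.Nontrivial) (η : DiscConf K n) :
    inclConf hK (retConf hK η) = expandMap hK (1, η) := by
  refine Conf.points_injective (funext fun i => funext fun j => ?_)
  rw [points_inclConf]
  exact discPoints_eq (fun _ hz => Conf.notMem_of_mem_points _ hz) (points_toSphere _ (i, j))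

theorem retConf_inclConf (hK : ∀ σ ∉ K, σ.Nontrivial) (w : SpherePolyProd K n) :
    retConf hK (inclConf hK w) = w := by
  refine Subtype.ext (funext fun a => SPInf.points_injective ?_)
  rw [retConf, points_toSphere,
    expandMap_of_factor hK (expansionFactor_of_margin 1 (margin_inclConf hK w)), points_inclConf,
    map_collapse_discPoints]

/-- The radial expansion as a homotopy relative to the polyhedral product. -/
def expandHomotopy (hK : ∀ σ ∉ K, σ.Nontrivial) :
    ContinuousMap.HomotopyRel (ContinuousMap.id (DiscConf K n))
      ((⟨inclConf hK, continuous_inclConf hK⟩ : C(SpherePolyProd K n, DiscConf K n)).comp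
        ⟨retConf hK, continuous_retConf hK⟩) (range (inclConf hK)) where
  toFun := expandMap hK
  continuous_toFun := continuous_expandMap hK
  map_zero_left η := expandMap_of_factor hK (expansionFactor_zero η)
  map_one_left η := (inclConf_retConf hK η).symm
  prop' t := by
    rintro _ ⟨w, rfl⟩
    exact expandMap_of_factor hK (expansionFactor_of_margin t (margin_inclConf hK w))

end Conf

/-- A homeomorphism that matches the subspaces induces one of polyhedral products. -/
def polyProdHomeomorph {V X Y : Type} [TopologicalSpace X] [TopologicalSpace Y]
    (K : Set (Finset V)) {A : Set X} {B : Set Y} (h : X ≃ₜ Y) (hAB : ∀ x, x ∈ A ↔ h x ∈ B) :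
    polyProd K X A ≃ₜ polyProd K Y B :=
  (Homeomorph.piCongrRight fun _ : V => h).subtype fun x =>
    exists_congr fun _ => and_congr_right fun _ => forall_congr' fun v =>
      imp_congr_right fun _ => hAB (x v)

/-! ### The complex of a fan -/

theorem empty_mem_fanComplex {m r : ℕ} (F : Fan m)
    (hF : {(⊥ : PointedCone ℝ (Fin m → ℝ))} ⊂ F.cones) (v : Fin r → Fin m → ℤ) :
    ∅ ∈ fanComplex F v := by
  have h : latticeCone (∅ : Set (Fin m → ℤ)) = ⊥ := by
    rw [latticeCone, image_empty]
    exact Submodule.span_empty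
  rw [fanComplex, mem_ofPred_eq, Finset.coe_empty, image_empty, h]
  exact hF.1 rfl

/-- Each lattice generator of `ρ` is a natural multiple of `w` by primitivity, so `w` alone
generates the cone. -/
theorem latticeCone_singleton_of_isPrimitiveGenerator {m : ℕ} {ρ : PointedCone ℝ (Fin m → ℝ)}
    {S : Finset (Fin m → ℤ)} (hS : ρ = latticeCone (S : Set (Fin m → ℤ))) {w : Fin m → ℤ}
    (hw : IsPrimitiveGenerator ρ w) : latticeCone {w} = ρ := by
  have hw' : ∀ u, latticeVec u ∈ ρ ↔ ∃ a : ℕ, u = a • w := fun u => Set.ext_iff.1 hw u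
  have hgen : latticeVec w ∈ latticeCone {w} :=
    Submodule.subset_span (mem_image_of_mem _ (mem_singleton w))
  refine le_antisymm (Submodule.span_le.2 ?_) ?_
  · rintro _ ⟨_, rfl, rfl⟩
    exact (hw' _).2 ⟨1, (one_smul ℕ _).symm⟩
  · rw [hS]
    refine Submodule.span_le.2 ?_
    rintro _ ⟨s, hs, rfl⟩
    obtain ⟨a, rfl⟩ := (hw' s).1 (hS ▸ Submodule.subset_span (mem_image_of_mem _ hs))
    have : latticeVec (a • w) = a • latticeVec w := by
      ext k
      simp [latticeVec]
    rw [this]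
    exact nsmul_mem hgen a

/-- The empty set spans the zero cone and a single primitive generator spans its ray; both are cones
of the fan. -/
theorem nontrivial_of_notMem_fanComplex {m r : ℕ} (F : Fan m)
    (hF : {(⊥ : PointedCone ℝ (Fin m → ℝ))} ⊂ F.cones) (ρ : Fin r → F.rays)
    (v : Fin r → Fin m → ℤ)
    (hv : ∀ k, IsPrimitiveGenerator (ρ k : PointedCone ℝ (Fin m → ℝ)) (v k)) :
    ∀ σ ∉ fanComplex F v, σ.Nontrivial := by
  intro σ hσ
  rcases σ.eq_empty_or_nonempty with rfl | hne
  · exact absurd (empty_mem_fanComplex F hF v) hσ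
  · obtain ⟨k, rfl⟩ | h := hne.exists_eq_singleton_or_nontrivial
    · refine absurd ?_ hσ
      obtain ⟨S, hS⟩ := F.rational _ (ρ k).2.1
      rw [fanComplex, mem_ofPred_eq, Finset.coe_singleton, image_singleton,
        latticeCone_singleton_of_isPrimitiveGenerator hS (hv k)]
      exact (ρ k).2.1
    · exact h

end

theorem mainTheorem8 {m r n : ℕ} (hn : 1 ≤ n) (F : Fan m)
    (hF : {(⊥ : PointedCone ℝ (Fin m → ℝ))} ⊂ F.cones)
    (ρ : Fin r ≃ F.rays) (v : Fin r → Fin m → ℤ)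
    (hv : ∀ k, IsPrimitiveGenerator (ρ k : PointedCone ℝ (Fin m → ℝ)) (v k)) :
    ∃ (rS : ContinuousMap.HomotopyEquiv (DiscConf (fanComplex F v) n)
          (DJ (thickComplex (fanComplex F v) n)))
      (h : SPSphere ≃ₜ CPInf)
      (incl : C(polyProd (thickComplex (fanComplex F v) n) SPSphere {w | w.points = 0},
        DiscConf (fanComplex F v) n))
      (ret : C(DiscConf (fanComplex F v) n,
        polyProd (thickComplex (fanComplex F v) n) SPSphere {w | w.points = 0}))
      (H : ContinuousMap.HomotopyRel (ContinuousMap.id (DiscConf (fanComplex F v) n))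
        (incl.comp ret) (Set.range incl))
      (l : C(unitInterval × DiscConf (fanComplex F v) n, ℝ)),
      -- `h` is a homeomorphism of based spaces
      (∀ w, w.points = 0 ↔ h w = CPInf.base) ∧
      -- `incl` is the inclusion given by the identification of `Ū / ∂Ū` with `S²`
      (∀ w i j, ((incl w).points i j).map collapse = (w.1 (i, j)).points) ∧
      -- `H` deforms `E_n(Ū, ∂Ū)` by radial expansion onto the image of `incl`, which stays fixed
      ret.comp incl = ContinuousMap.id _ ∧
      (∀ p, 1 ≤ l p) ∧
      (∀ t η i j, ((H (t, η)).points i j).map (Subtype.val : Disc → ℂ) =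
        radialExpand (l (t, η)) (η.points i j)) ∧
      -- the homotopy equivalence is the retraction followed by `h` in every coordinate
      (∀ η a, (rS η).1 a = h ((ret η).1 a)) := by
  have hK := nontrivial_of_notMem_fanComplex F hF ρ v hv
  obtain ⟨h, hh⟩ := exists_based_sphere_homeomorph
  let incl : C(SpherePolyProd (fanComplex F v) n, DiscConf (fanComplex F v) n) :=
    ⟨inclConf hK, continuous_inclConf hK⟩
  let ret : C(DiscConf (fanComplex F v) n, SpherePolyProd (fanComplex F v) n) :=
    ⟨retConf hK, continuous_retConf hK⟩
  let e : SpherePolyProd (fanComplex F v) n ≃ₜ DJ (thickComplex (fanComplex F v) n) :=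
    polyProdHomeomorph _ h hh
  have hret : ret.comp incl = ContinuousMap.id _ := ContinuousMap.ext (retConf_inclConf hK)
  let rS : ContinuousMap.HomotopyEquiv (DiscConf (fanComplex F v) n)
      (SpherePolyProd (fanComplex F v) n) :=
    ⟨ret, incl, ⟨(expandHomotopy hK).toHomotopy.symm⟩, hret ▸ ContinuousMap.Homotopic.refl _⟩
  refine ⟨rS.trans e.toHomotopyEquiv, h, incl, ret, expandHomotopy hK,
    ⟨expansionFactor, continuous_expansionFactor⟩, hh, fun w i j => ?_, hret,
    one_le_expansionFactor, fun t η i j => ?_, fun η a => rfl⟩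
  · exact (congrArg _ (points_inclConf hK w i j)).trans (map_collapse_discPoints _)
  · exact (congrArg _ (points_expandMap hK (t, η) i j)).trans (map_val_expandDisc _ _)
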